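/- Let $\Phi$ be a reduced, irreducible, crystallographic root system in a finite-dimensional $\mathbb{Q}$-vector space $E$ with Weyl group $W$, let $\Pi=\{\alpha_i\mid i\in I\}$ be a set of simple roots, $\Phi^+$ the corresponding set of positive roots, and $s_i\in W$ the reflection in $\alpha_i$; for $v\in E$ and $\alpha\in\Phi$ let $(v,\alpha^\vee)=2(v,\alpha)/(\alpha,\alpha)$. Let $\Lambda$ be the weight lattice, i.e. the set of all $v\in E$ with $(v,\alpha_i^\vee)\in\mathbb{Z}$ for all $i\in I$. A dominant weight $0\neq\lambda\in\Lambda$ is called minuscule if $(\lambda,\alpha^\vee)\in\{0,\pm1\}$ for all $\alpha\in\Phi$. Let $\Psi\subseteq\Lambda$ be a non-empty union of $W$-orbits of minuscule weights. Let $R$ be a commutative ring with $1$ and $\bar M$ a free $R$-module with basis $\{\bar z_\mu\mid\mu\in\Psi\}$. For $i\in I$ let $\bar e_i,\bar f_i\colon\bar M\to\bar M$ be the $R$-linear maps such that $\bar e_i(\bar z_\mu)=\bar z_{\mu+\alpha_i}$ if $(\mu,\alpha_i^\vee)=-1$ and $\bar e_i(\bar z_\mu)=0$ otherwise, and $\bar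 f_i(\bar z_\mu)=\bar z_{\mu-\alpha_i}$ if $(\mu,\alpha_i^\vee)=1$ and $\bar f_i(\bar z_\mu)=0$ otherwise. For $t\in R$ put $x_i(t)=\mathrm{id}+t\bar e_i$ and $y_i(t)=\mathrm{id}+t\bar f_i$; let $\bar n_i=x_i(1)y_i(-1)x_i(1)$ and $G=\langle x_i(t),y_i(t)\mid i\in I,\ t\in R\rangle\subseteq\mathrm{GL}(\bar M)$. For each $\alpha\in\Phi$ choose $i,i_1,\dots,i_k\in I$ such that $\alpha=s_{i_1}\cdots s_{i_k}(\alpha_i)$ and set $$\bar{\mathbf e}_\alpha=\bar n_{i_1}\cdots\bar n_{i_k}\,\bar e_i\,\bar n_{i_k}^{-1}\cdots\bar n_{i_1}^{-1},\qquad x_\alpha(t)=\mathrm{id}+t\bar{\mathbf e}_\alpha\ (t\in R),\qquad X_\alpha=\{x_\alpha(t)\mid t\in R\}.$$ Let $U^+=\langle x_\alpha(t)\mid\alpha\in\Phi^+,\ t\in R\rangle$. Then $X_\alpha\subseteq G$ for all $\alpha\in\Phi$, and, for every choice made above, the following hold. (a) $U^+=\prod_{\alpha\in\Phi^+}X_\alpha$,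 where the product of subsets is taken in any fixed order of $\Phi^+$. (b) Let $i\in I$ and $U_i^+=\langle X_\alpha\mid\alpha\in\Phi^+,\ \alpha\neq\alpha_i\rangle$. Then $U_i^+$ is a normal subgroup of $U^+$ and $U^+=X_{\alpha_i}U_i^+$; furthermore, $\bar n_iX_{\alpha_i}\bar n_i^{-1}=X_{-\alpha_i}$ and $\bar n_iU_i^+\bar n_i^{-1}=U_i^+$. -/

import Mathlib

open scoped Pointwise

/-!
Setting: `P` is a crystallographic root pairing over `ℚ` on `E` (the roots live in `E`), and `b` is
a base of `P`, so that the simple roots are the `P.root i` for `i : b.support`.  For a vector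
`v : E` and a root `α = P.root i` the number `(v, α^∨)` is `P.coroot' i v`; for every
Weyl-invariant inner product on `E` it equals `2 (v, α) / (α, α)`.
-/

namespace MinusculeChevalley

noncomputable section

section Weights

variable {ι E F : Type*} [AddCommGroup E] [Module ℚ E] [AddCommGroup F] [Module ℚ F]
  {P : RootPairing ι ℚ E F}

/-- The weight lattice: all `v` with `(v, α_i^∨) ∈ ℤ` for every simple root `α_i`.  For a root
system this is the `ℤ`-span of the basis dual to the simple coroots. -/
def weightLattice (b : P.Base) : Set E :=
  {v | ∀ i : b.support, ∃ n : ℤ, P.coroot' i v = n}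

/-- A non-zero dominant weight `v` is minuscule if `(v, α^∨) ∈ {0, 1, -1}` for all roots `α`. -/
structure IsMinuscule (b : P.Base) (v : E) : Prop where
  mem_weightLattice : v ∈ weightLattice b
  ne_zero : v ≠ 0
  dominant : ∀ i : b.support, 0 ≤ P.coroot' i v
  coroot_eq : ∀ i : ι, P.coroot' i v = 0 ∨ P.coroot' i v = 1 ∨ P.coroot' i v = -1

/-- `Ψ` is a non-empty union of Weyl group orbits of minuscule weights. -/
structure IsMinusculeUnion (b : P.Base) (Ψ : Set E) : Prop where
  nonempty : Ψ.Nonempty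
  eq_iUnion_orbit : ∃ S : Set E, (∀ v ∈ S, IsMinuscule b v) ∧
    Ψ = ⋃ v ∈ S, MulAction.orbit P.weylGroup v

theorem IsMinusculeUnion.reflection_mem {b : P.Base} {Ψ : Set E} (hΨ : IsMinusculeUnion b Ψ)
    (i : ι) {v : E} (hv : v ∈ Ψ) : P.reflection i v ∈ Ψ := by
  obtain ⟨S, -, rfl⟩ := hΨ.eq_iUnion_orbit
  simp only [Set.mem_iUnion] at hv ⊢
  obtain ⟨s, hs, hv⟩ := hv
  refine ⟨s, hs, ?_⟩
  have h := MulAction.mem_orbit_of_mem_orbit (RootPairing.weylGroup.ofIdx P i) hv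
  simpa using h

theorem IsMinusculeUnion.add_mem {b : P.Base} {Ψ : Set E} (hΨ : IsMinusculeUnion b Ψ)
    (i : ι) {v : E} (hv : v ∈ Ψ) (h : P.coroot' i v = -1) : v + P.root i ∈ Ψ := by
  have := hΨ.reflection_mem i hv
  rwa [RootPairing.reflection_apply, h, neg_one_smul, sub_neg_eq_add] at this

theorem IsMinusculeUnion.sub_mem {b : P.Base} {Ψ : Set E} (hΨ : IsMinusculeUnion b Ψ)
    (i : ι) {v : E} (hv : v ∈ Ψ) (h : P.coroot' i v = 1) : v - P.root i ∈ Ψ := by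
  have := hΨ.reflection_mem i hv
  rwa [RootPairing.reflection_apply, h, one_smul] at this

/-- An expression `α = s_{i₁} ⋯ s_{iₖ}(α_i)` of the root `α` with index `a`:
`word = [i₁, …, iₖ]` and `node = i`, all of them indices of simple roots. -/
structure RootWord (b : P.Base) (a : ι) where
  word : List b.support
  node : b.support
  root_eq : P.root a = word.foldr (fun (j : b.support) v => P.reflection j v) (P.root node)

/-- Every root has such an expression. -/
theorem RootWord.nonempty [Finite ι] [P.IsCrystallographic] [P.IsReduced] (b : P.Base) (a : ι) :
    Nonempty (RootWord b a) := by
  refine b.induction_reflect a (p := fun a => Nonempty (RootWord b a)) ?_ ?_ ?_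
  · rintro i ⟨⟨w, k, h⟩⟩
    refine ⟨⟨w ++ [k], k, ?_⟩⟩
    have key : ∀ l : List b.support, ∀ v : E, l.foldr (fun (j : b.support) v => P.reflection j v) (-v) =
        -l.foldr (fun (j : b.support) v => P.reflection j v) v := by
      intro l v
      induction l with
      | nil => rfl
      | cons j l ih => simp only [List.foldr_cons, ih, map_neg]
    rw [RootPairing.root_reflectionPerm, RootPairing.reflection_apply_self, h, List.foldr_append]
    simp only [List.foldr_cons, List.foldr_nil, RootPairing.reflection_apply_self, key]
  · intro i hi
    exact ⟨⟨[], ⟨i, hi⟩, rfl⟩⟩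
  · rintro i j ⟨⟨w, k, h⟩⟩ hj
    refine ⟨⟨⟨j, hj⟩ :: w, k, ?_⟩⟩
    rw [RootPairing.root_reflectionPerm, h, List.foldr_cons]

/-- The index of the root `-α`, where `a` is the index of `α`. -/
def negIdx (P : RootPairing ι ℚ E F) (a : ι) : ι := P.reflectionPerm a a

theorem root_negIdx (a : ι) : P.root (negIdx P a) = -P.root a := by
  rw [negIdx, RootPairing.root_reflectionPerm, RootPairing.reflection_apply_self]

end Weights

section Unipotent

variable {R M : Type*} [CommRing R] [AddCommGroup M] [Module R M]

/-- The element `id + t e` of `GL(M)`, where `e ^ 2 = 0`; its inverse is `id - t e`. -/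
def unip (e : Module.End R M) (he : e * e = 0) (t : R) : LinearMap.GeneralLinearGroup R M where
  val := 1 + t • e
  inv := 1 - t • e
  val_inv := by
    simp [add_mul, mul_sub, he]
  inv_val := by
    simp [mul_add, sub_mul, he]

end Unipotent

section Group

variable {ι E F : Type*} [AddCommGroup E] [Module ℚ E] [AddCommGroup F] [Module ℚ F]
  {P : RootPairing ι ℚ E F} {b : P.Base} {Ψ : Set E}
  {R M : Type*} [CommRing R] [AddCommGroup M] [Module R M]

/-- The linear map `e_i` on the free module with basis `z_μ`, `μ ∈ Ψ`:
`z_μ ↦ z_{μ + α_i}` if `(μ, α_i^∨) = -1`, and `z_μ ↦ 0` otherwise. -/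
def eMap (hΨ : IsMinusculeUnion b Ψ) (z : Module.Basis Ψ R M) (i : b.support) : Module.End R M :=
  open Classical in
  z.constr R fun μ : Ψ =>
    if h : P.coroot' i (μ : E) = -1 then z ⟨μ + P.root i, hΨ.add_mem i μ.2 h⟩ else 0

/-- The linear map `f_i` on the free module with basis `z_μ`, `μ ∈ Ψ`:
`z_μ ↦ z_{μ - α_i}` if `(μ, α_i^∨) = 1`, and `z_μ ↦ 0` otherwise. -/
def fMap (hΨ : IsMinusculeUnion b Ψ) (z : Module.Basis Ψ R M) (i : b.support) : Module.End R M :=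
  open Classical in
  z.constr R fun μ : Ψ =>
    if h : P.coroot' i (μ : E) = 1 then z ⟨μ - P.root i, hΨ.sub_mem i μ.2 h⟩ else 0

theorem eMap_mul_self (hΨ : IsMinusculeUnion b Ψ) (z : Module.Basis Ψ R M) (i : b.support) :
    eMap hΨ z i * eMap hΨ z i = 0 := by
  refine z.ext fun μ => ?_
  rw [Module.End.mul_apply, LinearMap.zero_apply, eMap, Module.Basis.constr_basis]
  split_ifs with h
  · rw [Module.Basis.constr_basis, dif_neg]
    rw [map_add, h, RootPairing.root_coroot'_eq_pairing, RootPairing.pairing_same]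
    norm_num
  · simp

theorem fMap_mul_self (hΨ : IsMinusculeUnion b Ψ) (z : Module.Basis Ψ R M) (i : b.support) :
    fMap hΨ z i * fMap hΨ z i = 0 := by
  refine z.ext fun μ => ?_
  rw [Module.End.mul_apply, LinearMap.zero_apply, fMap, Module.Basis.constr_basis]
  split_ifs with h
  · rw [Module.Basis.constr_basis, dif_neg]
    rw [map_sub, h, RootPairing.root_coroot'_eq_pairing, RootPairing.pairing_same]
    norm_num
  · simp

/-- `x_i(t) = id + t e_i`. -/
def xSimple (hΨ : IsMinusculeUnion b Ψ) (z : Module.Basis Ψ R M) (i : b.support) (t : R) :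
    LinearMap.GeneralLinearGroup R M :=
  unip (eMap hΨ z i) (eMap_mul_self hΨ z i) t

/-- `y_i(t) = id + t f_i`. -/
def ySimple (hΨ : IsMinusculeUnion b Ψ) (z : Module.Basis Ψ R M) (i : b.support) (t : R) :
    LinearMap.GeneralLinearGroup R M :=
  unip (fMap hΨ z i) (fMap_mul_self hΨ z i) t

/-- The Chevalley group `G_R(Ψ)`, generated by all `x_i(t)` and `y_i(t)` in `GL(M)`. -/
def chevalleyGroup (hΨ : IsMinusculeUnion b Ψ) (z : Module.Basis Ψ R M) :
    Subgroup (LinearMap.GeneralLinearGroup R M) :=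
  Subgroup.closure ({g | ∃ (i : b.support) (t : R), g = xSimple hΨ z i t} ∪
    {g | ∃ (i : b.support) (t : R), g = ySimple hΨ z i t})

/-- `n_i(t) = x_i(t) y_i(-t⁻¹) x_i(t)` for a unit `t`. -/
def nElt (hΨ : IsMinusculeUnion b Ψ) (z : Module.Basis Ψ R M) (i : b.support) (t : Rˣ) :
    LinearMap.GeneralLinearGroup R M :=
  xSimple hΨ z i t * ySimple hΨ z i (-(t⁻¹ : Rˣ)) * xSimple hΨ z i t

/-- The product `n_{i₁} ⋯ n_{iₖ}`, where `n_i = n_i(1)` and `w = [i₁, …, iₖ]`. -/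
def nWord (hΨ : IsMinusculeUnion b Ψ) (z : Module.Basis Ψ R M) (w : List b.support) :
    LinearMap.GeneralLinearGroup R M :=
  (w.map fun i => nElt hΨ z i 1).prod

/-- The root vector `e_α = n_{i₁} ⋯ n_{iₖ} e_i n_{iₖ}⁻¹ ⋯ n_{i₁}⁻¹` attached to a choice `c` of
expressions `α = s_{i₁} ⋯ s_{iₖ}(α_i)` of all roots `α`; here `a` is the index of `α`. -/
def rootVec (hΨ : IsMinusculeUnion b Ψ) (z : Module.Basis Ψ R M) (c : ∀ a, RootWord b a) (a : ι) :
    Module.End R M :=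
  (nWord hΨ z (c a).word : Module.End R M) * eMap hΨ z (c a).node *
    ((nWord hΨ z (c a).word)⁻¹ : LinearMap.GeneralLinearGroup R M)

theorem rootVec_mul_self (hΨ : IsMinusculeUnion b Ψ) (z : Module.Basis Ψ R M)
    (c : ∀ a, RootWord b a) (a : ι) : rootVec hΨ z c a * rootVec hΨ z c a = 0 := by
  have h := eMap_mul_self hΨ z (c a).node
  simp only [rootVec, mul_assoc, Units.inv_mul_cancel_left]
  rw [← mul_assoc (eMap hΨ z (c a).node), h, zero_mul, mul_zero]

/-- `x_α(t) = id + t e_α`. -/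
def xRoot (hΨ : IsMinusculeUnion b Ψ) (z : Module.Basis Ψ R M) (c : ∀ a, RootWord b a) (a : ι)
    (t : R) : LinearMap.GeneralLinearGroup R M :=
  unip (rootVec hΨ z c a) (rootVec_mul_self hΨ z c a) t

/-- The root subgroup `X_α = {x_α(t) | t ∈ R}`, as a subset of `GL(M)`. -/
def rootSubgroup (hΨ : IsMinusculeUnion b Ψ) (z : Module.Basis Ψ R M) (c : ∀ a, RootWord b a)
    (a : ι) : Set (LinearMap.GeneralLinearGroup R M) :=
  Set.range (xRoot hΨ z c a)

/-- `U⁺`, generated by all `x_α(t)` with `α` a positive root and `t ∈ R`. -/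
def uPlus (hΨ : IsMinusculeUnion b Ψ) (z : Module.Basis Ψ R M) (c : ∀ a, RootWord b a) :
    Subgroup (LinearMap.GeneralLinearGroup R M) :=
  Subgroup.closure {g | ∃ (a : ι) (t : R), b.IsPos a ∧ g = xRoot hΨ z c a t}

/-- `U_i⁺`, generated by all `X_α` with `α` a positive root different from `α_i`. -/
def uPlusMinus (hΨ : IsMinusculeUnion b Ψ) (z : Module.Basis Ψ R M) (c : ∀ a, RootWord b a)
    (i : b.support) : Subgroup (LinearMap.GeneralLinearGroup R M) :=
  Subgroup.closure (⋃ (a : ι) (_ : b.IsPos a ∧ a ≠ i), rootSubgroup hΨ z c a)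

end Group

end

end MinusculeChevalley

/-!
The root vectors `e_α` come by base change from operators over `ℤ`, and over `ℚ` they lie in the
Lie algebra generated by the `e_i` and `f_i`. In the triangular decomposition of this Lie algebra,
the part of positive weight is spanned by the iterated brackets of the `e_i`, so that its nonzero
weights are roots, with one-dimensional weight spaces. Evaluation on the weight vectors `z_μ`, all
of whose images under `e_α` are `0` or `±z_{μ+α}`, shows that an integral operator in such a weight
space is an integer multiple of the root vector. Hence `[e_α, e_β]` and `e_α e_β e_α` are, over
any `R`, integer multiples of root vectors, or zero.

For positive roots `α`, `β` one of `e_α e_β e_α` and `e_β e_α e_β` vanishes. As `e_α² = 0`, the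
commutator of `x_α(t)` and `x_β(u)` is then a product of two root elements whose roots have height
greater than those of `α` and `β`. The product decomposition of `U⁺` in any order and the normality
of `U_i⁺` follow from these commutator relations by filtering `U⁺` by height.
-/

open scoped commutatorElement

namespace MinusculeChevalley

noncomputable section

section GroupTheory

variable {G ι : Type*} [Group G] {X : ι → Subgroup G} {S : Set ι}

theorem biSup_induction {C : G → Prop} {x : G} (hx : x ∈ ⨆ c ∈ S, X c)
    (mem : ∀ c ∈ S, ∀ x ∈ X c, C x) (one : C 1) (mul : ∀ x y, C x → C y → C (x * y)) : C x := by
  rw [← iSup_subtype''] at hx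
  exact Subgroup.iSup_induction _ (C := C) hx (fun c => mem c c.2) one mul

theorem biSup_le_normalizer_biSup {T : Set ι}
    (h : ∀ a ∈ S, ∀ b ∈ T, ⁅X a, X b⁆ ≤ ⨆ c ∈ T, X c) :
    ⨆ a ∈ S, X a ≤ Subgroup.normalizer (⨆ b ∈ T, X b : Subgroup G) := by
  refine iSup₂_le fun a ha => Subgroup.le_normalizer_iff.2 fun x hx y hy => ?_
  refine biSup_induction (C := fun y => x * y * x⁻¹ ∈ ⨆ b ∈ T, X b) hy (fun b hb y hy => ?_)
    (by simp) fun y y' hy hy' => conj_mul (a := y) (b := x) (c := y') ▸ mul_mem hy hy'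
  rw [← inv_mul_cancel_right (x * y * x⁻¹) y]
  exact mul_mem (h a ha b hb (Subgroup.commutator_mem_commutator hx hy)) (le_biSup X hb hy)

theorem commutator_mem_of_biSup_le_normalizer {N : Subgroup G}
    (hN : ⨆ c ∈ S, X c ≤ Subgroup.normalizer N) {y : G}
    (h : ∀ c ∈ S, ∀ x ∈ X c, ⁅x, y⁆ ∈ N) {u : G} (hu : u ∈ ⨆ c ∈ S, X c) : ⁅u, y⁆ ∈ N := by
  refine (biSup_induction (C := fun u => u ∈ Subgroup.normalizer N ∧ ⁅u, y⁆ ∈ N) hu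
    (fun c hc x hx => ⟨hN (le_biSup X hc hx), h c hc x hx⟩) ⟨one_mem _, by simp⟩
    fun u v ⟨hu, hu'⟩ ⟨hv, hv'⟩ => ⟨mul_mem hu hv, ?_⟩).2
  rw [show ⁅u * v, y⁆ = u * ⁅v, y⁆ * u⁻¹ * ⁅u, y⁆ by simp only [commutatorElement_def]; group]
  exact mul_mem ((Subgroup.mem_normalizer_iff.1 hu _).1 hv') hu'

theorem prod_map_coe_subset_biSup {l : List ι} (hl : ∀ a ∈ l, a ∈ S) :
    (l.map fun a => (X a : Set G)).prod ⊆ (⨆ c ∈ S, X c : Subgroup G) := by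
  induction l with
  | nil => simp
  | cons a l ih =>
    simp only [List.forall_mem_cons] at hl
    rw [List.map_cons, List.prod_cons]
    exact Set.mul_subset_iff.2 fun x hx y hy => mul_mem (le_biSup X hl.1 hx) (ih hl.2 hy)

theorem one_mem_prod_map_coe (l : List ι) : (1 : G) ∈ (l.map fun a => (X a : Set G)).prod := by
  induction l with
  | nil => simp
  | cons a l ih =>
    rw [List.map_cons, List.prod_cons]
    exact ⟨1, one_mem (X a), 1, ih, mul_one 1⟩

theorem mul_mem_prod_mul_of_mem {N : Subgroup G}
    (hN : ⨆ c ∈ S, X c ≤ Subgroup.normalizer N) {l : List ι} (hl : ∀ a ∈ l, a ∈ S) {b : ι}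
    (hb : b ∈ l) (hcomm : ∀ a ∈ S, ⁅X a, X b⁆ ≤ N) {x y : G}
    (hx : x ∈ (l.map fun a => (X a : Set G)).prod) (hy : y ∈ X b) :
    x * y ∈ (l.map fun a => (X a : Set G)).prod * (N : Set G) := by
  induction l generalizing x with
  | nil => simp at hb
  | cons a l ih =>
    simp only [List.forall_mem_cons] at hl
    rw [List.map_cons, List.prod_cons] at hx ⊢
    obtain ⟨x₁, hx₁, x₂, hx₂, rfl⟩ := hx
    obtain rfl | hb := List.mem_cons.1 hb
    · have hv : ⁅x₂⁻¹, y⁻¹⁆ ∈ N := commutator_mem_of_biSup_le_normalizer hN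
        (fun c hc x hx => hcomm c hc (Subgroup.commutator_mem_commutator hx (inv_mem hy)))
        (inv_mem (prod_map_coe_subset_biSup hl.2 hx₂))
      refine ⟨x₁ * y * x₂, ⟨x₁ * y, mul_mem hx₁ hy, x₂, hx₂, rfl⟩, _, hv, ?_⟩
      simp only [commutatorElement_def]
      group
    · rw [mul_assoc, mul_assoc]
      exact Set.mul_mem_mul hx₁ (ih hl.2 hb hx₂)

theorem mul_mem_prod_mul_of_mem_biSup {N : Subgroup G}
    (hN : ⨆ c ∈ S, X c ≤ Subgroup.normalizer N) {l : List ι} (hl : ∀ a, a ∈ l ↔ a ∈ S) {T : Set ι}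
    (hT : T ⊆ S) (hcomm : ∀ a ∈ S, ∀ b ∈ T, ⁅X a, X b⁆ ≤ N) {x y : G}
    (hx : x ∈ (l.map fun a => (X a : Set G)).prod * (N : Set G)) (hy : y ∈ ⨆ c ∈ T, X c) :
    x * y ∈ (l.map fun a => (X a : Set G)).prod * (N : Set G) := by
  refine biSup_induction (C := fun y => ∀ x ∈ (l.map fun a => (X a : Set G)).prod * (N : Set G),
    x * y ∈ (l.map fun a => (X a : Set G)).prod * (N : Set G)) hy (fun b hb y hy x hx => ?_)
    (by simp) (fun y y' hy hy' x hx => mul_assoc x y y' ▸ hy' _ (hy x hx)) x hx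
  obtain ⟨p, hp, w, hw, rfl⟩ := hx
  have hw' : y⁻¹ * w * y ∈ N :=
    (Subgroup.mem_normalizer_iff''.1 (hN (le_biSup X (hT hb) hy)) w).1 hw
  have hpy := mul_mem_prod_mul_of_mem hN (fun a => (hl a).1) ((hl b).2 (hT hb))
    (fun a ha => hcomm a ha b hb) hp hy
  rw [show p * w * y = p * y * (y⁻¹ * w * y) by group]
  simpa only [mul_assoc, coe_mul_coe] using Set.mul_mem_mul hpy hw'

theorem biSup_eq_prod_of_commutator_le (ht : ι → ℕ)
    (hcomm : ∀ a ∈ S, ∀ b ∈ S, ⁅X a, X b⁆ ≤ ⨆ c ∈ {c ∈ S | ht b < ht c}, X c)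
    {l : List ι} (hl : ∀ a, a ∈ l ↔ a ∈ S) :
    ((⨆ c ∈ S, X c : Subgroup G) : Set G) = (l.map fun a => (X a : Set G)).prod := by
  refine Set.Subset.antisymm (fun u hu => ?_) (prod_map_coe_subset_biSup fun a => (hl a).1)
  let U (h : ℕ) : Subgroup G := ⨆ c ∈ {c ∈ S | h ≤ ht c}, X c
  have hU {h k : ℕ} (hk : h ≤ k) : U k ≤ U h := biSup_mono fun _ hc => ⟨hc.1, hk.trans hc.2⟩
  have hN (h : ℕ) : ⨆ c ∈ S, X c ≤ Subgroup.normalizer (U h) :=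
    biSup_le_normalizer_biSup fun a ha b hb =>
      (hcomm a ha b hb.1).trans (hU (Nat.le_succ_of_le hb.2))
  have hprod (h : ℕ) : u ∈ (l.map fun a => (X a : Set G)).prod * (U h : Set G) := by
    induction h with
    | zero => exact ⟨1, one_mem_prod_map_coe l, u, by simpa [U] using hu, one_mul u⟩
    | succ h ih =>
      obtain ⟨x, hx, v, hv, rfl⟩ := ih
      exact mul_mem_prod_mul_of_mem_biSup (hN (h + 1)) hl (fun b hb => hb.1)
        (fun a ha b hb => (hcomm a ha b hb.1).trans (hU (Nat.succ_le_succ hb.2)))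
        ⟨x, hx, 1, one_mem _, mul_one x⟩ hv
  have hbot : U ((l.map ht).sum + 1) = ⊥ := eq_bot_iff.2 <| iSup₂_le fun c hc =>
    absurd (List.single_le_sum (by simp) (ht c) (List.mem_map_of_mem ((hl c).2 hc.1)))
      (Nat.not_le_of_lt hc.2)
  simpa [hbot] using hprod ((l.map ht).sum + 1)

end GroupTheory

section Triangular

variable {K L I D : Type*} [CommRing K] [LieRing L] [LieAlgebra K L] [AddCommGroup D] [Module K D]

/-- The iterated bracket `[e_{j₁}, [e_{j₂}, … [e_{jₖ}, e_i] … ]]` of the word `[j₁, …, jₖ]`. -/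
def iterBracket (e : I → L) (i : I) : List I → L
  | [] => e i
  | j :: w => ⁅e j, iterBracket e i w⁆

theorem iterBracket_eq_zero (e : I → L) (i : I) {w : List I} (hw : w ≠ [])
    (h : ∀ j ∈ w, j = i) : iterBracket e i w = 0 := by
  induction w with
  | nil => exact absurd rfl hw
  | cons j w ih =>
    simp only [List.forall_mem_cons] at h
    obtain rfl | hw' := eq_or_ne w []
    · rw [iterBracket, iterBracket, h.1, lie_self]
    · rw [iterBracket, ih hw' h.2, lie_zero]

/-- The iterated brackets of the `e_i` and the elements of the image of `d`. If `d` acts diagonally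
on the `e_i`, they span the Lie subalgebra generated by the `e_i` and the image of `d`. -/
def borelGenerators (e : I → L) (d : D →ₗ[K] L) : Set L :=
  Set.range d ∪ {x | ∃ i w, x = iterBracket e i w}

/-- The sum of the two opposite Borel subalgebras attached to the `e_i` and to the `f_i`. -/
def triangularSpan (e f : I → L) (d : D →ₗ[K] L) : Submodule K L :=
  Submodule.span K (borelGenerators e d) ⊔ Submodule.span K (borelGenerators f d)

theorem iterBracket_mem_borelGenerators (e : I → L) (d : D →ₗ[K] L) (i : I) (w : List I) :
    iterBracket e i w ∈ borelGenerators e d :=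
  Or.inr ⟨i, w, rfl⟩

theorem mem_triangularSpan (e f : I → L) (d : D →ₗ[K] L) (i : I) :
    e i ∈ triangularSpan e f d :=
  Submodule.mem_sup_left (Submodule.subset_span (iterBracket_mem_borelGenerators e d i []))

theorem triangularSpan_comm (e f : I → L) (d : D →ₗ[K] L) :
    triangularSpan e f d = triangularSpan f e d :=
  sup_comm _ _

theorem exists_lie_iterBracket_eq_smul {e : I → L} {y : L} (h : ∀ i, ∃ c : K, ⁅y, e i⁆ = c • e i)
    (i : I) (w : List I) : ∃ c : K, ⁅y, iterBracket e i w⁆ = c • iterBracket e i w := by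
  induction w with
  | nil => exact h i
  | cons j w ih =>
    obtain ⟨c, hc⟩ := h j
    obtain ⟨c', hc'⟩ := ih
    exact ⟨c + c', by rw [iterBracket, leibniz_lie, hc, hc', smul_lie, lie_smul, ← add_smul]⟩

theorem lie_mem_span_borelGenerators {e : I → L} {d : D →ₗ[K] L}
    (hde : ∀ φ i, ∃ c : K, ⁅d φ, e i⁆ = c • e i) (i : I) {x : L}
    (hx : x ∈ Submodule.span K (borelGenerators e d)) :
    ⁅e i, x⁆ ∈ Submodule.span K (borelGenerators e d) := by
  refine (Submodule.span_le (p := (Submodule.span K (borelGenerators e d)).comap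
    (LieAlgebra.ad K L (e i) : L →ₗ[K] L))).2 ?_ hx
  have hmem (w) : iterBracket e i w ∈ Submodule.span K (borelGenerators e d) :=
    Submodule.subset_span (iterBracket_mem_borelGenerators e d i w)
  rintro _ (⟨φ, rfl⟩ | ⟨j, w, rfl⟩)
  · obtain ⟨c, hc⟩ := hde φ i
    change ⁅e i, d φ⁆ ∈ Submodule.span K (borelGenerators e d)
    rw [← lie_skew, hc]
    exact neg_mem (Submodule.smul_mem _ c (hmem []))
  · exact Submodule.subset_span (iterBracket_mem_borelGenerators e d j (i :: w))

/-- The commutation relations of the Chevalley generators `e_i`, `f_i` of a semisimple Lie algebra,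
where `d` parametrizes the Cartan subalgebra. -/
structure TriangularRelations (e f : I → L) (d : D →ₗ[K] L) : Prop where
  lie_d_e : ∀ φ i, ∃ c : K, ⁅d φ, e i⁆ = c • e i
  lie_d_f : ∀ φ i, ∃ c : K, ⁅d φ, f i⁆ = c • f i
  lie_e_f_self : ∀ i, ∃ φ, ⁅e i, f i⁆ = d φ
  lie_e_f_of_ne : ∀ i j, i ≠ j → ⁅e i, f j⁆ = 0

namespace TriangularRelations

variable {e f : I → L} {d : D →ₗ[K] L}

theorem symm (h : TriangularRelations e f d) : TriangularRelations f e d where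
  lie_d_e := h.lie_d_f
  lie_d_f := h.lie_d_e
  lie_e_f_self i := by
    obtain ⟨φ, hφ⟩ := h.lie_e_f_self i
    exact ⟨-φ, by rw [← lie_skew, hφ, map_neg]⟩
  lie_e_f_of_ne i j hij := by rw [← lie_skew, h.lie_e_f_of_ne j i hij.symm, neg_zero]

theorem lie_iterBracket_mem (h : TriangularRelations e f d) (i j : I) (w : List I) :
    ⁅e i, iterBracket f j w⁆ ∈ Submodule.span K (borelGenerators f d) := by
  have hef (l : I) : ∃ φ, ⁅e i, f l⁆ = d φ := by
    obtain rfl | hil := eq_or_ne i l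
    · exact h.lie_e_f_self i
    · exact ⟨0, by rw [h.lie_e_f_of_ne i l hil, map_zero]⟩
  induction w with
  | nil =>
    obtain ⟨φ, hφ⟩ := hef j
    exact hφ ▸ Submodule.subset_span (Or.inl ⟨φ, rfl⟩)
  | cons l w ih =>
    obtain ⟨φ, hφ⟩ := hef l
    obtain ⟨c, hc⟩ := exists_lie_iterBracket_eq_smul (h.lie_d_f φ) j w
    rw [iterBracket, leibniz_lie, hφ, hc]
    exact add_mem
      (Submodule.smul_mem _ c (Submodule.subset_span (iterBracket_mem_borelGenerators f d j w)))
      (lie_mem_span_borelGenerators h.lie_d_f l ih)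

theorem lie_mem (h : TriangularRelations e f d) (i : I) {x : L} (hx : x ∈ triangularSpan e f d) :
    ⁅e i, x⁆ ∈ triangularSpan e f d := by
  obtain ⟨y, hy, z, hz, rfl⟩ := Submodule.mem_sup.1 hx
  rw [lie_add]
  refine add_mem (Submodule.mem_sup_left (lie_mem_span_borelGenerators h.lie_d_e i hy)) ?_
  refine (Submodule.span_le (p := (triangularSpan e f d).comap
    (LieAlgebra.ad K L (e i) : L →ₗ[K] L))).2 ?_ hz
  rintro _ (⟨φ, rfl⟩ | ⟨j, w, rfl⟩)
  · exact Submodule.mem_sup_left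
      (lie_mem_span_borelGenerators h.lie_d_e i (Submodule.subset_span (Or.inl ⟨φ, rfl⟩)))
  · exact Submodule.mem_sup_right (h.lie_iterBracket_mem i j w)

end TriangularRelations

end Triangular

section SimpleRootWords

variable {ι E F : Type*} [AddCommGroup E] [Module ℚ E] [AddCommGroup F] [Module ℚ F]
  {P : RootPairing ι ℚ E F} {b : P.Base}

/-- The sum of the simple roots `α_{i₁}, …, α_{iₖ}` named by the word `[i₁, …, iₖ]`. Up to
permutation, the words are the elements of the positive cone of the root lattice. -/
def wordSum (w : List b.support) : E := (w.map fun i : b.support => P.root i).sum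

@[simp] theorem wordSum_nil : wordSum ([] : List b.support) = 0 := rfl

@[simp] theorem wordSum_cons (i : b.support) (w : List b.support) :
    wordSum (i :: w) = P.root i + wordSum w := by
  simp [wordSum]

@[simp] theorem wordSum_append (w w' : List b.support) :
    wordSum (w ++ w') = wordSum w + wordSum w' := by
  simp [wordSum]

theorem wordSum_replicate (n : ℕ) (i : b.support) :
    wordSum (List.replicate n i) = n • P.root i := by
  simp [wordSum]

theorem wordSum_inj {w w' : List b.support} : wordSum w = wordSum w' ↔ w.Perm w' := by
  classical
  refine ⟨fun h => ?_, fun h => (h.map fun i : b.support => P.root i).sum_eq⟩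
  have hli : LinearIndependent ℕ fun i : b.support => P.root i :=
    LinearIndependent.restrict_scalars' ℕ b.linearIndepOn_root
  have hsum (w : List b.support) : wordSum w =
      Finsupp.linearCombination ℕ (fun i : b.support => P.root i)
        (Multiset.toFinsupp (w : Multiset b.support)) := by
    induction w with
    | nil => simp
    | cons i w ih =>
      rw [wordSum_cons, ih, ← Multiset.cons_coe, ← Multiset.singleton_add, map_add, map_add,
        Multiset.toFinsupp_singleton, Finsupp.linearCombination_single, one_smul]
  rw [hsum, hsum] at h
  exact Multiset.coe_eq_coe.1 (Multiset.toFinsupp.injective (hli h))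

theorem eq_nil_of_wordSum_add_eq_zero {w w' : List b.support} (h : wordSum w + wordSum w' = 0) :
    w = [] := by
  rw [← wordSum_append, ← wordSum_nil (b := b), wordSum_inj, List.perm_nil] at h
  exact (List.append_eq_nil_iff.1 h).1

theorem wordSum_ne_neg_wordSum {w : List b.support} (hw : w ≠ []) (u : List b.support) :
    wordSum w ≠ -wordSum u :=
  fun h => hw (eq_nil_of_wordSum_add_eq_zero (eq_neg_iff_add_eq_zero.1 h))

section Positive

variable [Finite ι] [P.IsCrystallographic]

theorem exists_root_eq_wordSum {a : ι} (ha : b.IsPos a) :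
    ∃ w : List b.support, w ≠ [] ∧ P.root a = wordSum w := by
  refine ha.induction_on_add (p := fun a => ∃ w : List b.support, w ≠ [] ∧ P.root a = wordSum w)
    (fun i hi => ?_) fun i j k hk hi hj => ?_
  · exact ⟨[⟨i, hi⟩], List.cons_ne_nil _ _, by simp⟩
  · obtain ⟨w, -, hw⟩ := hi
    exact ⟨⟨j, hj⟩ :: w, List.cons_ne_nil _ _, by rw [hk, hw, wordSum_cons, add_comm]⟩

end Positive

/-- The product of the reflections `s_{i₁} ⋯ s_{iₖ}`, where `w = [i₁, …, iₖ]`. -/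
def wordRefl (w : List b.support) : E ≃ₗ[ℚ] E :=
  (w.map fun i : b.support => P.reflection i).prod

theorem wordRefl_cons_apply (i : b.support) (w : List b.support) (v : E) :
    wordRefl (i :: w) v = P.reflection i (wordRefl w v) := by
  simp [wordRefl]

theorem foldr_reflection_eq (w : List b.support) (v : E) :
    w.foldr (fun (j : b.support) v => P.reflection j v) v = wordRefl w v := by
  induction w with
  | nil => rfl
  | cons i w ih => rw [List.foldr_cons, ih, wordRefl_cons_apply]

theorem coroot'_wordRefl (w : List b.support) {a i : ι}
    (h : P.root a = wordRefl w (P.root i)) (v : E) :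
    P.coroot' a (wordRefl w v) = P.coroot' i v := by
  induction w generalizing a with
  | nil =>
    obtain rfl : a = i := P.root.injective h
    rfl
  | cons j w ih =>
    rw [wordRefl_cons_apply] at h ⊢
    rw [P.coroot'_reflection]
    refine ih ?_
    rw [RootPairing.root_reflectionPerm, h, RootPairing.reflection_same]

theorem RootWord.wordRefl_root {a : ι} (r : RootWord b a) :
    wordRefl r.word (P.root r.node) = P.root a := by
  rw [← foldr_reflection_eq, ← r.root_eq]

end SimpleRootWords

section WeightOperators

variable {E R M : Type*} {Ψ : Set E} [CommRing R] [AddCommGroup M] [Module R M]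

/-- The vector `z_v` for an arbitrary `v : E`, with the convention `z_v = 0` for `v ∉ Ψ`. -/
def weightVec (z : Module.Basis Ψ R M) (v : E) : M :=
  open Classical in if h : v ∈ Ψ then z ⟨v, h⟩ else 0

/-- The coefficient of `z_v`, with value `0` for `v ∉ Ψ`. -/
def weightCoord (z : Module.Basis Ψ R M) (v : E) : M →ₗ[R] R :=
  open Classical in if h : v ∈ Ψ then z.coord ⟨v, h⟩ else 0

variable {z : Module.Basis Ψ R M}

@[simp] theorem weightVec_coe (μ : Ψ) : weightVec z μ = z μ := by
  simp [weightVec]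

theorem weightVec_of_notMem {v : E} (h : v ∉ Ψ) : weightVec z v = 0 := by
  simp [weightVec, h]

theorem end_ext_weightVec (z : Module.Basis Ψ R M) {X Y : Module.End R M}
    (h : ∀ u ∈ Ψ, X (weightVec z u) = Y (weightVec z u)) : X = Y :=
  z.ext fun μ => weightVec_coe (z := z) μ ▸ h μ μ.2

theorem weightCoord_smul_weightVec_self (v : E) (r : R) :
    weightCoord z v (r • weightVec z v) • weightVec z v = r • weightVec z v := by
  by_cases h : v ∈ Ψ <;> simp [weightCoord, weightVec, h]

theorem weightCoord_weightVec_of_ne {v w : E} (h : v ≠ w) :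
    weightCoord z v (weightVec z w) = 0 := by
  by_cases hv : v ∈ Ψ <;> by_cases hw : w ∈ Ψ <;>
    simp [weightCoord, weightVec, hv, hw, h.symm]

variable [AddCommGroup E]

/-- The operator `X` maps each `z_u` to a multiple of `z_{u + v}`. -/
def HasWeight (z : Module.Basis Ψ R M) (X : Module.End R M) (v : E) : Prop :=
  ∀ u, ∃ r : R, X (weightVec z u) = r • weightVec z (u + v)

/-- The component of weight `v` of an operator. -/
def weightProj (z : Module.Basis Ψ R M) (v : E) : Module.End R M →ₗ[R] Module.End R M where
  toFun X := z.constr R fun μ : Ψ => weightCoord z (μ + v) (X (z μ)) • weightVec z (μ + v)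
  map_add' X Y := z.ext fun μ => by simp [add_smul]
  map_smul' r X := z.ext fun μ => by simp [mul_smul]

/-- The diagonal operator with eigenvalue `φ v` on `z_v`. -/
def diagMap (z : Module.Basis Ψ R M) : (E →+ R) →ₗ[R] Module.End R M where
  toFun φ := z.constr R fun μ : Ψ => φ μ • z μ
  map_add' φ ψ := z.ext fun μ => by simp [add_smul]
  map_smul' r φ := z.ext fun μ => by simp [mul_smul]

theorem diagMap_weightVec (φ : E →+ R) (v : E) :
    diagMap z φ (weightVec z v) = φ v • weightVec z v := by
  by_cases hv : v ∈ Ψ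
  · simp [weightVec, hv, diagMap]
  · simp [weightVec_of_notMem hv]

namespace HasWeight

variable {X Y : Module.End R M} {v w : E}

theorem mul (hX : HasWeight z X v) (hY : HasWeight z Y w) : HasWeight z (X * Y) (v + w) := by
  intro u
  obtain ⟨r, hr⟩ := hY u
  obtain ⟨r', hr'⟩ := hX (u + w)
  exact ⟨r * r', by rw [Module.End.mul_apply, hr, map_smul, hr', smul_smul, add_assoc, add_comm w]⟩

theorem sub (hX : HasWeight z X v) (hY : HasWeight z Y v) : HasWeight z (X - Y) v := by
  intro u
  obtain ⟨r, hr⟩ := hX u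
  obtain ⟨r', hr'⟩ := hY u
  exact ⟨r - r', by rw [LinearMap.sub_apply, hr, hr', sub_smul]⟩

theorem lie (hX : HasWeight z X v) (hY : HasWeight z Y w) : HasWeight z ⁅X, Y⁆ (v + w) :=
  (hX.mul hY).sub (by rw [add_comm]; exact hY.mul hX)

theorem lie_diagMap (hX : HasWeight z X v) (φ : E →+ R) : ⁅diagMap z φ, X⁆ = φ v • X := by
  refine end_ext_weightVec z fun u _ => ?_
  obtain ⟨r, hr⟩ := hX u
  rw [Ring.lie_def, LinearMap.sub_apply, Module.End.mul_apply, Module.End.mul_apply,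
    LinearMap.smul_apply, diagMap_weightVec, map_smul, hr, map_smul, diagMap_weightVec, map_add]
  module

theorem weightProj_self (hX : HasWeight z X v) : weightProj z v X = X := by
  refine z.ext fun μ => ?_
  obtain ⟨r, hr⟩ := hX μ
  rw [weightVec_coe] at hr
  simp only [weightProj, LinearMap.coe_mk, AddHom.coe_mk, Module.Basis.constr_basis, hr,
    weightCoord_smul_weightVec_self]

theorem weightProj_of_ne (hX : HasWeight z X v) (h : w ≠ v) : weightProj z w X = 0 := by
  refine z.ext fun μ => ?_
  obtain ⟨r, hr⟩ := hX μ
  rw [weightVec_coe] at hr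
  simp only [weightProj, LinearMap.coe_mk, AddHom.coe_mk, Module.Basis.constr_basis, hr, map_smul,
    weightCoord_weightVec_of_ne (fun hw => h (add_left_cancel hw)), smul_zero, zero_smul,
    LinearMap.zero_apply]

theorem eq_of_ne_zero (hX : HasWeight z X v) (hX' : HasWeight z X w) (h : X ≠ 0) : v = w := by
  by_contra hvw
  exact h (by rw [← hX.weightProj_self, hX'.weightProj_of_ne hvw])

theorem mem_span_of_mem_span {S : Set (Module.End R M)} (hS : ∀ Y ∈ S, ∃ w, HasWeight z Y w)
    (hX : HasWeight z X v) (h : X ∈ Submodule.span R S) :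
    X ∈ Submodule.span R {Y ∈ S | HasWeight z Y v} := by
  have hproj : Submodule.span R S ≤
      (Submodule.span R {Y ∈ S | HasWeight z Y v}).comap (weightProj z v) := by
    refine Submodule.span_le.2 fun Y hY => ?_
    obtain ⟨w, hw⟩ := hS Y hY
    obtain rfl | hvw := eq_or_ne v w
    · exact Submodule.subset_span (hw.weightProj_self.symm ▸ ⟨hY, hw⟩)
    · simp [hw.weightProj_of_ne hvw]
  exact hX.weightProj_self ▸ hproj h

end HasWeight

theorem hasWeight_diagMap (φ : E →+ R) : HasWeight z (diagMap z φ) 0 := fun u =>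
  ⟨φ u, by rw [diagMap_weightVec, add_zero]⟩

/-- The automorphism `g` permutes the `z_v` up to signs in the same way as `s` permutes `E`. -/
def LiftsUpToSign (z : Module.Basis Ψ R M) (g : LinearMap.GeneralLinearGroup R M)
    (s : E ≃+ E) : Prop :=
  ∀ u, ∃ ε : ℤˣ, (g : Module.End R M) (weightVec z u) = ε • weightVec z (s u)

theorem toConjAct_smul_apply (g : LinearMap.GeneralLinearGroup R M) (X : Module.End R M)
    (x : M) : (ConjAct.toConjAct g • X) x =
      (g : Module.End R M) (X ((↑g⁻¹ : Module.End R M) x)) := rfl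

namespace LiftsUpToSign

variable {g h : LinearMap.GeneralLinearGroup R M} {s t : E ≃+ E}

theorem one : LiftsUpToSign z 1 (.refl E) := fun _ => ⟨1, by simp⟩

theorem mul (hg : LiftsUpToSign z g s) (hh : LiftsUpToSign z h t) :
    LiftsUpToSign z (g * h) (t.trans s) := by
  intro u
  obtain ⟨ε, hε⟩ := hh u
  obtain ⟨δ, hδ⟩ := hg (t u)
  exact ⟨ε * δ, by rw [Units.val_mul, Module.End.mul_apply, hε, map_zsmul_unit, hδ, smul_smul]; rfl⟩

theorem inv (hg : LiftsUpToSign z g s) : LiftsUpToSign z g⁻¹ s.symm := by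
  intro u
  obtain ⟨ε, hε⟩ := hg (s.symm u)
  rw [s.apply_symm_apply] at hε
  refine ⟨ε⁻¹, ?_⟩
  rw [eq_inv_smul_iff, ← map_zsmul_unit, ← hε]
  exact LinearMap.congr_fun g.inv_mul _

theorem hasWeight_conj (hg : LiftsUpToSign z g s) {X : Module.End R M} {v : E}
    (hX : HasWeight z X v) : HasWeight z (ConjAct.toConjAct g • X) (s v) := by
  intro u
  obtain ⟨ε, hε⟩ := hg.inv u
  obtain ⟨r, hr⟩ := hX (s.symm u)
  obtain ⟨δ, hδ⟩ := hg (s.symm u + v)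
  rw [map_add, s.apply_symm_apply] at hδ
  refine ⟨ε • δ • r, ?_⟩
  rw [toConjAct_smul_apply, hε, map_zsmul_unit, map_zsmul_unit, hr, map_smul, hδ, smul_assoc,
    smul_assoc, smul_comm r δ]

end LiftsUpToSign

end WeightOperators

section MinusculeOperators

attribute [local instance] LieRing.ofAssociativeRing

variable {ι E F : Type*} [AddCommGroup E] [Module ℚ E] [AddCommGroup F] [Module ℚ F]
  {P : RootPairing ι ℚ E F} {b : P.Base} {Ψ : Set E}

theorem coroot'_root_self (i : ι) : P.coroot' i (P.root i) = 2 := by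
  rw [RootPairing.root_coroot'_eq_pairing, RootPairing.pairing_same]

theorem IsMinusculeUnion.coroot'_eq (hΨ : IsMinusculeUnion b Ψ) {v : E} (hv : v ∈ Ψ) (a : ι) :
    P.coroot' a v = 0 ∨ P.coroot' a v = 1 ∨ P.coroot' a v = -1 := by
  obtain ⟨S, hS, rfl⟩ := hΨ.eq_iUnion_orbit
  simp only [Set.mem_iUnion] at hv
  obtain ⟨s, hs, ⟨⟨g, hg⟩, rfl⟩⟩ := hv
  have : Nonempty ι := ⟨a⟩
  suffices ∀ v : E, (∀ a, P.coroot' a v = 0 ∨ P.coroot' a v = 1 ∨ P.coroot' a v = -1) →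
      ∀ a, P.coroot' a ((⟨g, hg⟩ : P.weylGroup) • v) = 0 ∨
        P.coroot' a ((⟨g, hg⟩ : P.weylGroup) • v) = 1 ∨
        P.coroot' a ((⟨g, hg⟩ : P.weylGroup) • v) = -1 from this s (hS s hs).coroot_eq a
  clear hs
  induction hg using RootPairing.weylGroup.induction' with
  | mem i =>
    intro v hv a
    have h := hv (P.reflectionPerm i a)
    rwa [← P.coroot'_reflection] at h
  | mul _ _ _ _ h₁ h₂ => exact fun v hv => h₁ _ (h₂ v hv)

theorem IsMinusculeUnion.reflection_mem_iff (hΨ : IsMinusculeUnion b Ψ) (i : ι) {v : E} :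
    P.reflection i v ∈ Ψ ↔ v ∈ Ψ :=
  ⟨fun h => by simpa using hΨ.reflection_mem i h, hΨ.reflection_mem i⟩

variable {R M : Type*} [CommRing R] [AddCommGroup M] [Module R M]
  (hΨ : IsMinusculeUnion b Ψ) (z : Module.Basis Ψ R M)

theorem eMap_weightVec (i : b.support) (v : E) :
    eMap hΨ z i (weightVec z v) =
      if P.coroot' i v = -1 then weightVec z (v + P.root i) else 0 := by
  by_cases hv : v ∈ Ψ
  · rw [weightVec, dif_pos hv, eMap, Module.Basis.constr_basis]
    split_ifs with h
    · rw [weightVec, dif_pos]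
    · rfl
  · rw [weightVec_of_notMem hv, map_zero]
    split_ifs with h
    · have hs : P.reflection i v = v + P.root i := by
        rw [RootPairing.reflection_apply, h, neg_one_smul, sub_neg_eq_add]
      rw [← hs, weightVec_of_notMem ((hΨ.reflection_mem_iff i).not.2 hv)]
    · rfl

theorem fMap_weightVec (i : b.support) (v : E) :
    fMap hΨ z i (weightVec z v) =
      if P.coroot' i v = 1 then weightVec z (v - P.root i) else 0 := by
  by_cases hv : v ∈ Ψ
  · rw [weightVec, dif_pos hv, fMap, Module.Basis.constr_basis]
    split_ifs with h
    · rw [weightVec, dif_pos]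
    · rfl
  · rw [weightVec_of_notMem hv, map_zero]
    split_ifs with h
    · have hs : P.reflection i v = v - P.root i := by
        rw [RootPairing.reflection_apply, h, one_smul]
      rw [← hs, weightVec_of_notMem ((hΨ.reflection_mem_iff i).not.2 hv)]
    · rfl

theorem hasWeight_eMap (i : b.support) : HasWeight z (eMap hΨ z i) (P.root i) := by
  intro u
  rw [eMap_weightVec]
  split_ifs
  · exact ⟨1, (one_smul _ _).symm⟩
  · exact ⟨0, (zero_smul _ _).symm⟩

theorem hasWeight_fMap (i : b.support) : HasWeight z (fMap hΨ z i) (-P.root i) := by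
  intro u
  rw [fMap_weightVec]
  split_ifs
  · exact ⟨1, by rw [one_smul, sub_eq_add_neg]⟩
  · exact ⟨0, (zero_smul _ _).symm⟩

theorem hasWeight_iterBracket_eMap (i : b.support) (w : List b.support) :
    HasWeight z (iterBracket (eMap hΨ z) i w) (wordSum (i :: w)) := by
  induction w with
  | nil => simpa [iterBracket] using hasWeight_eMap hΨ z i
  | cons j w ih =>
    rw [wordSum_cons, wordSum_cons, add_left_comm, ← wordSum_cons]
    exact (hasWeight_eMap hΨ z j).lie ih

theorem hasWeight_iterBracket_fMap (i : b.support) (w : List b.support) :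
    HasWeight z (iterBracket (fMap hΨ z) i w) (-wordSum (i :: w)) := by
  induction w with
  | nil => simpa [iterBracket] using hasWeight_fMap hΨ z i
  | cons j w ih =>
    rw [wordSum_cons, wordSum_cons, add_left_comm, ← wordSum_cons, neg_add]
    exact (hasWeight_fMap hΨ z j).lie ih

theorem val_nElt_one (i : b.support) : (nElt hΨ z i 1 : Module.End R M) =
    (1 + eMap hΨ z i) * (1 - fMap hΨ z i) * (1 + eMap hΨ z i) := by
  simp [nElt, xSimple, ySimple, unip, sub_eq_add_neg]

theorem liftsUpToSign_nElt (i : b.support) :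
    LiftsUpToSign z (nElt hΨ z i 1) (P.reflection i).toAddEquiv := by
  intro v
  by_cases hv : v ∈ Ψ
  · have hs := P.reflection_apply i v
    have hsub : P.coroot' i (v - P.root i) = P.coroot' i v - 2 := by
      rw [map_sub, coroot'_root_self]
    have hadd : P.coroot' i (v + P.root i) = P.coroot' i v + 2 := by
      rw [map_add, coroot'_root_self]
    simp only [val_nElt_one, Module.End.mul_apply, LinearMap.add_apply, LinearMap.sub_apply,
      Module.End.one_apply, LinearEquiv.coe_toAddEquiv]
    rcases hΨ.coroot'_eq hv i with h | h | h <;> rw [h] at hs hsub hadd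
    · exact ⟨1, by simp [eMap_weightVec, fMap_weightVec, h, hs]⟩
    · exact ⟨-1, by norm_num [eMap_weightVec, fMap_weightVec, h, hs, hsub]; abel⟩
    · exact ⟨1, by norm_num [eMap_weightVec, fMap_weightVec, h, hs, hadd]⟩
  · exact ⟨1, by
      rw [weightVec_of_notMem hv, map_zero,
        weightVec_of_notMem (v := (P.reflection i).toAddEquiv v)
          ((hΨ.reflection_mem_iff i).not.2 hv), smul_zero]⟩

theorem liftsUpToSign_nWord (w : List b.support) :
    LiftsUpToSign z (nWord hΨ z w) (wordRefl w).toAddEquiv := by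
  induction w with
  | nil => exact .one
  | cons i w ih =>
    rw [nWord, List.map_cons, List.prod_cons]
    exact (liftsUpToSign_nElt hΨ z i).mul ih

theorem lie_eMap_fMap_self {V : Type*} [AddCommGroup V] [Module ℚ V] (z : Module.Basis Ψ ℚ V)
    (i : b.support) :
    ⁅eMap hΨ z i, fMap hΨ z i⁆ = diagMap z (P.coroot' i).toAddMonoidHom := by
  refine end_ext_weightVec z fun v hv => ?_
  have hsub : P.coroot' i (v - P.root i) = P.coroot' i v - 2 := by
    rw [map_sub, coroot'_root_self]
  have hadd : P.coroot' i (v + P.root i) = P.coroot' i v + 2 := by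
    rw [map_add, coroot'_root_self]
  rw [Ring.lie_def, LinearMap.sub_apply, Module.End.mul_apply, Module.End.mul_apply,
    diagMap_weightVec, LinearMap.toAddMonoidHom_coe]
  rcases hΨ.coroot'_eq hv i with h | h | h <;> rw [h] at hsub hadd ⊢ <;>
    norm_num [eMap_weightVec, fMap_weightVec, h, hsub, hadd]

variable [Finite ι] [P.IsCrystallographic]

theorem coroot'_root_nonpos {i j : b.support} (hij : i ≠ j) : P.coroot' i (P.root j) ≤ 0 := by
  rw [RootPairing.root_coroot'_eq_pairing, ← P.algebraMap_pairingIn ℤ]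
  have := b.pairingIn_le_zero_of_ne (i := j) (j := i) (fun h => hij (Subtype.ext h.symm)) j.2 i.2
  simpa using this

theorem eMap_mul_fMap_of_ne {i j : b.support} (hij : i ≠ j) :
    eMap hΨ z i * fMap hΨ z j = fMap hΨ z j * eMap hΨ z i := by
  refine end_ext_weightVec z fun v hv => ?_
  have hp := coroot'_root_nonpos hij
  have hq := coroot'_root_nonpos hij.symm
  have hpq : P.coroot' i (P.root j) = 0 ↔ P.coroot' j (P.root i) = 0 := by
    rw [RootPairing.root_coroot'_eq_pairing, RootPairing.root_coroot'_eq_pairing]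
    exact P.pairing_eq_zero_iff
  have hiff : P.coroot' j v = 1 ∧ P.coroot' i (v - P.root j) = -1 ↔
      P.coroot' i v = -1 ∧ P.coroot' j (v + P.root i) = 1 := by
    rw [map_sub, map_add]
    rcases hΨ.coroot'_eq hv i with hi | hi | hi <;> rcases hΨ.coroot'_eq hv j with hj | hj | hj <;>
      grind
  rw [Module.End.mul_apply, Module.End.mul_apply, eMap_weightVec, fMap_weightVec,
    apply_ite (eMap hΨ z i), apply_ite (fMap hΨ z j), eMap_weightVec, fMap_weightVec, map_zero,
    map_zero, ← ite_and, ← ite_and, sub_add_eq_add_sub]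
  exact if_congr hiff rfl rfl

theorem triangularRelations {V : Type*} [AddCommGroup V] [Module ℚ V]
    (z : Module.Basis Ψ ℚ V) :
    TriangularRelations (eMap hΨ z) (fMap hΨ z) (diagMap z) where
  lie_d_e φ i := ⟨_, (hasWeight_eMap hΨ z i).lie_diagMap φ⟩
  lie_d_f φ i := ⟨_, (hasWeight_fMap hΨ z i).lie_diagMap φ⟩
  lie_e_f_self i := ⟨_, lie_eMap_fMap_self hΨ z i⟩
  lie_e_f_of_ne i j hij := by rw [Ring.lie_def, eMap_mul_fMap_of_ne hΨ z hij, sub_self]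

end MinusculeOperators

section RootVectors

variable {ι E F : Type*} [AddCommGroup E] [Module ℚ E] [AddCommGroup F] [Module ℚ F]
  {P : RootPairing ι ℚ E F} {b : P.Base} {Ψ : Set E}
  {R M : Type*} [CommRing R] [AddCommGroup M] [Module R M]
  (hΨ : IsMinusculeUnion b Ψ) (z : Module.Basis Ψ R M) {a a' : ι}

namespace RootWord

/-- The root vector `n_{i₁} ⋯ n_{iₖ} e_i n_{iₖ}⁻¹ ⋯ n_{i₁}⁻¹` attached to the expression
`α = s_{i₁} ⋯ s_{iₖ}(α_i)`. -/
def vec (r : RootWord b a) : Module.End R M :=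
  ConjAct.toConjAct (nWord hΨ z r.word) • eMap hΨ z r.node

/-- The expression `s_i(α) = s_i s_{i₁} ⋯ s_{iₖ}(α_j)` obtained from `α = s_{i₁} ⋯ s_{iₖ}(α_j)`. -/
def cons (i : b.support) (r : RootWord b a) : RootWord b (P.reflectionPerm i a) where
  word := i :: r.word
  node := r.node
  root_eq := by rw [RootPairing.root_reflectionPerm, r.root_eq, List.foldr_cons]

theorem toConjAct_nElt_smul_vec (i : b.support) (r : RootWord b a) :
    ConjAct.toConjAct (nElt hΨ z i 1) • r.vec hΨ z = (r.cons i).vec hΨ z := by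
  rw [vec, smul_smul, ← map_mul]
  rfl

theorem exists_vec_weightVec (r : RootWord b a) (u : E) : ∃ ε : ℤˣ,
    r.vec hΨ z (weightVec z u) =
      if P.coroot' a u = -1 then ε • weightVec z (u + P.root a) else 0 := by
  have hn := liftsUpToSign_nWord hΨ z r.word
  set v := (wordRefl r.word).symm u with hv
  have hcoroot : P.coroot' r.node v = P.coroot' a u := by
    rw [← coroot'_wordRefl r.word r.wordRefl_root.symm, hv, LinearEquiv.apply_symm_apply]
  have hroot : wordRefl r.word (v + P.root r.node) = u + P.root a := by
    rw [map_add, hv, LinearEquiv.apply_symm_apply, r.wordRefl_root]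
  obtain ⟨ε, hε⟩ : ∃ ε : ℤˣ, (↑(nWord hΨ z r.word)⁻¹ : Module.End R M) (weightVec z u) =
      ε • weightVec z v := hn.inv u
  obtain ⟨δ, hδ⟩ : ∃ δ : ℤˣ, (nWord hΨ z r.word : Module.End R M)
      (weightVec z (v + P.root r.node)) = δ • weightVec z (u + P.root a) := hroot ▸ hn _
  refine ⟨ε * δ, ?_⟩
  rw [vec, toConjAct_smul_apply, hε, map_zsmul_unit, map_zsmul_unit, eMap_weightVec, hcoroot,
    apply_ite (nWord hΨ z r.word : Module.End R M), map_zero, hδ, smul_ite, smul_zero, smul_smul]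

theorem hasWeight_vec (r : RootWord b a) : HasWeight z (r.vec hΨ z) (P.root a) := by
  rw [← r.wordRefl_root]
  exact (liftsUpToSign_nWord hΨ z r.word).hasWeight_conj (hasWeight_eMap hΨ z r.node)

theorem vec_mul_self (r : RootWord b a) : r.vec hΨ z * r.vec hΨ z = 0 := by
  rw [vec, ← smul_mul', eMap_mul_self, smul_zero]

theorem vec_mul_vec_mul_vec_eq_zero (r : RootWord b a) (r' : RootWord b a')
    (h : P.pairing a' a ≠ -2) : r.vec hΨ z * r'.vec hΨ z * r.vec hΨ z = 0 := by
  refine end_ext_weightVec z fun u _ => ?_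
  obtain ⟨ε, hε⟩ := r.exists_vec_weightVec hΨ z u
  obtain ⟨δ, hδ⟩ := r'.exists_vec_weightVec hΨ z (u + P.root a)
  obtain ⟨ε', hε'⟩ := r.exists_vec_weightVec hΨ z (u + P.root a + P.root a')
  rw [map_add, map_add, coroot'_root_self, RootPairing.root_coroot'_eq_pairing] at hε'
  rw [Module.End.mul_apply, Module.End.mul_apply, hε, LinearMap.zero_apply]
  by_cases hu : P.coroot' a u = -1
  · have hne : P.coroot' a u + 2 + P.pairing a' a ≠ -1 := fun h' => h (by linarith)
    rw [if_neg hne] at hε'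
    rw [if_pos hu, map_zsmul_unit, hδ, map_zsmul_unit, apply_ite (r.vec hΨ z), map_zsmul_unit, hε',
      smul_zero, map_zero, ite_self, smul_zero]
  · rw [if_neg hu, map_zero, map_zero]

end RootWord

end RootVectors

section ChevalleyGroup

attribute [local instance] LieRing.ofAssociativeRing

theorem unip_inv {R M : Type*} [CommRing R] [AddCommGroup M] [Module R M] (e : Module.End R M)
    (he : e * e = 0) (t : R) : (unip e he t)⁻¹ = unip e he (-t) :=
  Units.ext (show 1 - t • e = 1 + -t • e by rw [neg_smul, sub_eq_add_neg])

theorem lie_lie_eq_neg_two_smul {A : Type*} [Ring A] [Algebra ℚ A] {e : A} (he : e * e = 0)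
    (x : A) : ⁅e, ⁅e, x⁆⁆ = -(2 : ℚ) • (e * x * e) := by
  have hexpand : ⁅e, ⁅e, x⁆⁆ = e * e * x + x * (e * e) - (e * x * e + e * x * e) := by
    simp only [Ring.lie_def]
    noncomm_ring
  rw [hexpand, he, zero_mul, mul_zero]
  module

theorem toConjAct_unip_smul_mem {V : Type*} [AddCommGroup V] [Module ℚ V]
    {S : Submodule ℚ (Module.End ℚ V)} {e : Module.End ℚ V} (he : e * e = 0)
    (hS : ∀ x ∈ S, ⁅e, x⁆ ∈ S) (t : ℚ) {x : Module.End ℚ V} (hx : x ∈ S) :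
    ConjAct.toConjAct (unip e he t) • x ∈ S := by
  have hexp : ConjAct.toConjAct (unip e he t) • x =
      x + t • ⁅e, x⁆ + (t ^ 2 / 2) • ⁅e, ⁅e, x⁆⁆ := by
    have hconj : ConjAct.toConjAct (unip e he t) • x = (1 + t • e) * x * (1 - t • e) := rfl
    rw [hconj, lie_lie_eq_neg_two_smul he, Ring.lie_def]
    simp only [mul_sub, add_mul, one_mul, mul_one, smul_mul_assoc, mul_smul_comm, smul_sub]
    module
  rw [hexp]
  exact add_mem (add_mem hx (S.smul_mem _ (hS _ hx))) (S.smul_mem _ (hS _ (hS _ hx)))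

variable {ι E F : Type*} [AddCommGroup E] [Module ℚ E] [AddCommGroup F] [Module ℚ F]
  {P : RootPairing ι ℚ E F} {b : P.Base} {Ψ : Set E}
  {R M : Type*} [CommRing R] [AddCommGroup M] [Module R M]
  (hΨ : IsMinusculeUnion b Ψ) (z : Module.Basis Ψ R M)

theorem xSimple_mem_chevalleyGroup (i : b.support) (t : R) :
    xSimple hΨ z i t ∈ chevalleyGroup hΨ z :=
  Subgroup.subset_closure (Or.inl ⟨i, t, rfl⟩)

theorem nElt_mem_chevalleyGroup (i : b.support) (t : Rˣ) :
    nElt hΨ z i t ∈ chevalleyGroup hΨ z :=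
  mul_mem (mul_mem (xSimple_mem_chevalleyGroup hΨ z i t)
    (Subgroup.subset_closure (Or.inr ⟨i, _, rfl⟩))) (xSimple_mem_chevalleyGroup hΨ z i t)

theorem nWord_mem_chevalleyGroup (w : List b.support) :
    nWord hΨ z w ∈ chevalleyGroup hΨ z :=
  list_prod_mem fun x hx => by
    obtain ⟨i, -, rfl⟩ := List.mem_map.1 hx
    exact nElt_mem_chevalleyGroup hΨ z i 1

end ChevalleyGroup

section ChevalleyAlgebra

attribute [local instance] LieRing.ofAssociativeRing

variable {ι E F : Type*} [AddCommGroup E] [Module ℚ E] [AddCommGroup F] [Module ℚ F]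
  {P : RootPairing ι ℚ E F} {b : P.Base} {Ψ : Set E}
  {V : Type*} [AddCommGroup V] [Module ℚ V]

/-- The Lie algebra of the Chevalley group over `ℚ`, in its triangular decomposition, enlarged by
all diagonal operators whose eigenvalue on `z_μ` is additive in `μ`. -/
def chevalleyAlgebra (hΨ : IsMinusculeUnion b Ψ) (z : Module.Basis Ψ ℚ V) :
    Submodule ℚ (Module.End ℚ V) :=
  triangularSpan (eMap hΨ z) (fMap hΨ z) (diagMap z)

variable {hΨ : IsMinusculeUnion b Ψ} {z : Module.Basis Ψ ℚ V} {X : Module.End ℚ V} {a : ι}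

theorem mem_span_iterBracket_of_hasWeight (hX : X ∈ chevalleyAlgebra hΨ z) {v : E}
    (hXv : HasWeight z X v) (hv : ∀ u : List b.support, v ≠ -wordSum u) :
    X ∈ Submodule.span ℚ {Y | ∃ i w, Y = iterBracket (eMap hΨ z) i w ∧ wordSum (i :: w) = v} := by
  have hgen : ∀ Y ∈ borelGenerators (eMap hΨ z) (diagMap z) ∪
      borelGenerators (fMap hΨ z) (diagMap z), ∃ w, HasWeight z Y w := by
    rintro Y ((⟨φ, rfl⟩ | ⟨i, w, rfl⟩) | (⟨φ, rfl⟩ | ⟨i, w, rfl⟩))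
    exacts [⟨_, hasWeight_diagMap φ⟩, ⟨_, hasWeight_iterBracket_eMap hΨ z i w⟩,
      ⟨_, hasWeight_diagMap φ⟩, ⟨_, hasWeight_iterBracket_fMap hΨ z i w⟩]
  rw [chevalleyAlgebra, triangularSpan, ← Submodule.span_union] at hX
  refine Submodule.span_le.2 ?_ (hXv.mem_span_of_mem_span hgen hX)
  rintro Y ⟨hY, hYv⟩
  obtain rfl | hY0 := eq_or_ne Y 0
  · exact zero_mem _
  obtain (⟨φ, rfl⟩ | ⟨i, w, rfl⟩) | (⟨φ, rfl⟩ | ⟨i, w, rfl⟩) := hY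
  · exact absurd (hYv.eq_of_ne_zero (hasWeight_diagMap φ) hY0) (by simpa using hv [])
  · exact Submodule.subset_span
      ⟨i, w, rfl, (hasWeight_iterBracket_eMap hΨ z i w).eq_of_ne_zero hYv hY0⟩
  · exact absurd (hYv.eq_of_ne_zero (hasWeight_diagMap φ) hY0) (by simpa using hv [])
  · exact absurd (hYv.eq_of_ne_zero (hasWeight_iterBracket_fMap hΨ z i w) hY0) (hv _)

theorem exists_iterBracket_ne_zero_of_hasWeight (hX : X ∈ chevalleyAlgebra hΨ z) (hX0 : X ≠ 0)
    {v : E} (hXv : HasWeight z X v) (hv : ∀ u : List b.support, v ≠ -wordSum u) :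
    ∃ i w, iterBracket (eMap hΨ z) i w ≠ 0 ∧ wordSum (i :: w) = v := by
  by_contra! h
  refine hX0 ((Submodule.mem_bot ℚ).1
    (Submodule.span_le.2 ?_ (mem_span_iterBracket_of_hasWeight hX hXv hv)))
  rintro Y ⟨i, w, rfl, hw⟩
  exact not_imp_comm.1 (h i w) (not_not.2 hw)

theorem exists_eq_smul_eMap (i : b.support) (hX : X ∈ chevalleyAlgebra hΨ z)
    (hXi : HasWeight z X (P.root i)) : ∃ q : ℚ, q • eMap hΨ z i = X := by
  rw [← Submodule.mem_span_singleton]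
  have hroot : P.root i = wordSum [i] := by simp
  refine Submodule.span_mono ?_ (mem_span_iterBracket_of_hasWeight hX hXi
    (hroot ▸ wordSum_ne_neg_wordSum (List.cons_ne_nil _ _)))
  rintro Y ⟨j, w, rfl, hw⟩
  rw [hroot, wordSum_inj, List.perm_singleton, List.cons.injEq] at hw
  rw [hw.1, hw.2]
  rfl

variable [Finite ι] [P.IsCrystallographic]

theorem toConjAct_smul_mem_chevalleyAlgebra {g : LinearMap.GeneralLinearGroup ℚ V}
    (hg : g ∈ chevalleyGroup hΨ z) (hX : X ∈ chevalleyAlgebra hΨ z) :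
    ConjAct.toConjAct g • X ∈ chevalleyAlgebra hΨ z := by
  have hlie_e (i : b.support) (Y) (hY : Y ∈ chevalleyAlgebra hΨ z) :
      ⁅eMap hΨ z i, Y⁆ ∈ chevalleyAlgebra hΨ z := (triangularRelations hΨ z).lie_mem i hY
  have hlie_f (i : b.support) (Y) (hY : Y ∈ chevalleyAlgebra hΨ z) :
      ⁅fMap hΨ z i, Y⁆ ∈ chevalleyAlgebra hΨ z := by
    rw [chevalleyAlgebra, triangularSpan_comm] at hY ⊢
    exact (triangularRelations hΨ z).symm.lie_mem i hY
  induction hg using Subgroup.closure_induction'' generalizing X with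
  | mem g hg =>
    obtain ⟨i, t, rfl⟩ | ⟨i, t, rfl⟩ := hg
    · exact toConjAct_unip_smul_mem _ (hlie_e i) t hX
    · exact toConjAct_unip_smul_mem _ (hlie_f i) t hX
  | inv_mem g hg =>
    obtain ⟨i, t, rfl⟩ | ⟨i, t, rfl⟩ := hg
    · rw [xSimple, unip_inv]
      exact toConjAct_unip_smul_mem _ (hlie_e i) (-t) hX
    · rw [ySimple, unip_inv]
      exact toConjAct_unip_smul_mem _ (hlie_f i) (-t) hX
  | one => simpa using hX
  | mul g h _ _ ihg ihh =>
    rw [map_mul, mul_smul]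
    exact ihg (ihh hX)

theorem RootWord.vec_mem_chevalleyAlgebra (r : RootWord b a) :
    r.vec hΨ z ∈ chevalleyAlgebra hΨ z :=
  toConjAct_smul_mem_chevalleyAlgebra (nWord_mem_chevalleyGroup hΨ z _)
    (mem_triangularSpan _ _ _ _)

theorem RootWord.lie_vec_mem_chevalleyAlgebra (r : RootWord b a)
    (hX : X ∈ chevalleyAlgebra hΨ z) : ⁅r.vec hΨ z, X⁆ ∈ chevalleyAlgebra hΨ z := by
  have hg := nWord_mem_chevalleyGroup hΨ z r.word
  have hlie := (triangularRelations hΨ z).lie_mem r.node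
    (toConjAct_smul_mem_chevalleyAlgebra (inv_mem hg) hX)
  have hconj := toConjAct_smul_mem_chevalleyAlgebra hg hlie
  rwa [Ring.lie_def, smul_sub, smul_mul', smul_mul', smul_smul, ← map_mul, mul_inv_cancel, map_one,
    one_smul] at hconj

theorem RootWord.exists_eq_smul_vec (r : RootWord b a) (hX : X ∈ chevalleyAlgebra hΨ z)
    (hXa : HasWeight z X (P.root a)) : ∃ q : ℚ, q • r.vec hΨ z = X := by
  have hg := nWord_mem_chevalleyGroup hΨ z r.word
  have hweight := (liftsUpToSign_nWord hΨ z r.word).inv.hasWeight_conj hXa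
  rw [← r.wordRefl_root] at hweight
  obtain ⟨q, hq⟩ := exists_eq_smul_eMap r.node
    (toConjAct_smul_mem_chevalleyAlgebra (inv_mem hg) hX) (by simpa using hweight)
  refine ⟨q, ?_⟩
  rw [vec, smul_comm, hq, smul_smul, ← map_mul, mul_inv_cancel, map_one, one_smul]

theorem exists_iterBracket_ne_zero_of_reflection {i : b.support} {w : List b.support} (hw : w ≠ [])
    (h : iterBracket (eMap hΨ z) i w ≠ 0) {j : b.support} {n : ℕ}
    (hn : P.coroot' j (wordSum (i :: w)) = n) :
    ∃ i' w', iterBracket (eMap hΨ z) i' w' ≠ 0 ∧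
      wordSum (i' :: w') = P.reflection j (wordSum (i :: w)) ∧
      (i :: w).Perm (i' :: w' ++ List.replicate n j) := by
  have hrefl : P.reflection j (wordSum (i :: w)) + wordSum (List.replicate n j) =
      wordSum (i :: w) := by
    rw [RootPairing.reflection_apply, hn, wordSum_replicate, ← Nat.cast_smul_eq_nsmul ℚ,
      sub_add_cancel]
  have hne (u : List b.support) : P.reflection j (wordSum (i :: w)) ≠ -wordSum u := by
    intro hu
    rw [hu, neg_add_eq_iff_eq_add, ← wordSum_append, wordSum_inj] at hrefl
    have hj (l) (hl : l ∈ i :: w) : l = j :=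
      List.eq_of_mem_replicate (hrefl.mem_iff.2 (List.mem_append_right u hl))
    refine h (iterBracket_eq_zero _ i hw fun l hl => ?_)
    rw [hj l (List.mem_cons_of_mem i hl), hj i List.mem_cons_self]
  obtain ⟨i', w', h', hw'⟩ := exists_iterBracket_ne_zero_of_hasWeight
    (toConjAct_smul_mem_chevalleyAlgebra (nElt_mem_chevalleyGroup hΨ z j 1)
      (Submodule.mem_sup_left (Submodule.subset_span (iterBracket_mem_borelGenerators _ _ i w))))
    ((smul_ne_zero_iff_ne _).2 h)
    ((liftsUpToSign_nElt hΨ z j).hasWeight_conj (hasWeight_iterBracket_eMap hΨ z i w)) hne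
  refine ⟨i', w', h', hw', ?_⟩
  rw [← wordSum_inj, wordSum_append, hw']
  exact hrefl.symm

/-- Induction on the length of the word: if the outermost bracket is with `e_j` and the inner one
has weight `α_k`, then either `(α_k, α_j^∨) < 0` and `α_k + α_j` is a root, or conjugation by `n_j`
leads to a shorter non-zero bracket. -/
theorem wordSum_mem_range_root_of_iterBracket_ne_zero {i : b.support} {w : List b.support}
    (h : iterBracket (eMap hΨ z) i w ≠ 0) : wordSum (i :: w) ∈ Set.range P.root := by
  induction hl : w.length using Nat.strong_induction_on generalizing i w with
  | _ l ih =>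
  cases w with
  | nil => exact ⟨i, by simp⟩
  | cons j w =>
    subst hl
    have hw : iterBracket (eMap hΨ z) i w ≠ 0 := fun h0 => h (by rw [iterBracket, h0, lie_zero])
    obtain ⟨k, hk⟩ := ih w.length (by simp) hw rfl
    have hsum : wordSum (i :: j :: w) = P.root k + P.root j := by
      rw [hk, wordSum_cons, wordSum_cons, wordSum_cons]
      abel
    rw [hsum]
    obtain hneg | hnonneg := lt_or_ge (P.pairingIn ℤ k j) 0
    · refine P.root_add_root_mem_of_pairingIn_neg hneg ?_
      rw [hk]
      simpa using wordSum_ne_neg_wordSum (List.cons_ne_nil i w) [j]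
    · obtain ⟨n, hn⟩ := Int.eq_ofNat_of_zero_le hnonneg
      have hcoroot : P.coroot' j (wordSum (i :: j :: w)) = (n + 2 : ℕ) := by
        rw [hsum, map_add, coroot'_root_self, RootPairing.root_coroot'_eq_pairing,
          ← P.algebraMap_pairingIn ℤ, hn]
        simp
      obtain ⟨i', w', h', hw', hperm⟩ :=
        exists_iterBracket_ne_zero_of_reflection (List.cons_ne_nil j w) h hcoroot
      have hlength : w'.length < (j :: w).length := by
        have := hperm.length_eq
        simp only [List.length_append, List.length_cons, List.length_replicate] at this ⊢
        omega
      obtain ⟨m, hm⟩ := ih _ hlength h' rfl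
      refine ⟨P.reflectionPerm j m, ?_⟩
      rw [RootPairing.root_reflectionPerm, hm, hw', RootPairing.reflection_same, hsum]

theorem wordSum_mem_range_root_of_hasWeight (hX : X ∈ chevalleyAlgebra hΨ z) (hX0 : X ≠ 0)
    {w : List b.support} (hw : w ≠ []) (hXw : HasWeight z X (wordSum w)) :
    wordSum w ∈ Set.range P.root := by
  obtain ⟨i, w', h, hw'⟩ :=
    exists_iterBracket_ne_zero_of_hasWeight hX hX0 hXw (wordSum_ne_neg_wordSum hw)
  exact hw' ▸ wordSum_mem_range_root_of_iterBracket_ne_zero h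

end ChevalleyAlgebra

section BaseChange

attribute [local instance] LieRing.ofAssociativeRing

variable {E : Type*} {Ψ : Set E} {N : Type*} [AddCommGroup N]
  {R M : Type*} [CommRing R] [AddCommGroup M] [Module R M]

/-- The base change map `∑ n_μ y_μ ↦ ∑ n_μ z_μ` from a lattice with basis `y` to the free `R`-module
with basis `z`. -/
def baseVec (y : Module.Basis Ψ ℤ N) (z : Module.Basis Ψ R M) : N →ₗ[ℤ] M :=
  y.constr ℤ z

theorem baseVec_weightVec (y : Module.Basis Ψ ℤ N) (z : Module.Basis Ψ R M) (v : E) :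
    baseVec y z (weightVec y v) = weightVec z v := by
  by_cases hv : v ∈ Ψ
  · simp [baseVec, weightVec, hv]
  · simp [weightVec_of_notMem hv]

/-- The base change of operators along `baseVec`, a homomorphism `End ℤ N → End R M`. -/
def baseMap (y : Module.Basis Ψ ℤ N) (z : Module.Basis Ψ R M) :
    Module.End ℤ N →+* Module.End R M :=
  have apply_baseVec (T : Module.End ℤ N) (n : N) :
      z.constr R (fun μ => baseVec y z (T (y μ))) (baseVec y z n) = baseVec y z (T n) := by
    suffices (z.constr R fun μ => baseVec y z (T (y μ))).restrictScalars ℤ ∘ₗ baseVec y z =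
      baseVec y z ∘ₗ T from LinearMap.congr_fun this n
    exact y.ext fun μ => by simp [baseVec]
  { toFun T := z.constr R fun μ => baseVec y z (T (y μ))
    map_one' := z.ext fun μ => by simp [baseVec]
    map_mul' S T := z.ext fun μ => by simp [apply_baseVec]
    map_zero' := z.ext fun μ => by simp
    map_add' S T := z.ext fun μ => by simp }

theorem baseMap_weightVec (y : Module.Basis Ψ ℤ N) (z : Module.Basis Ψ R M) (T : Module.End ℤ N)
    (v : E) : baseMap y z T (weightVec z v) = baseVec y z (T (weightVec y v)) := by
  by_cases hv : v ∈ Ψ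
  · simp [baseMap, weightVec, hv]
  · simp [weightVec_of_notMem hv]

theorem HasWeight.baseMap [AddCommGroup E] {y : Module.Basis Ψ ℤ N} {T : Module.End ℤ N} {v : E}
    (hT : HasWeight y T v) (z : Module.Basis Ψ R M) : HasWeight z (baseMap y z T) v := by
  intro u
  obtain ⟨n, hn⟩ := hT u
  exact ⟨n, by rw [baseMap_weightVec, hn, map_smul, baseVec_weightVec, Int.cast_smul_eq_zsmul]⟩

theorem baseMap_injective [CharZero R] (y : Module.Basis Ψ ℤ N) (z : Module.Basis Ψ R M) :
    Function.Injective (baseMap y z) := by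
  have hinj : Function.Injective (baseVec y z) := by
    have hli : LinearIndependent ℤ z := LinearIndependent.restrict_scalars' ℤ z.linearIndependent
    have hcomp : ⇑(baseVec y z) = Finsupp.linearCombination ℤ z ∘ y.repr :=
      funext fun n => by rw [baseVec, Module.Basis.constr_apply]; rfl
    exact hcomp ▸ Function.Injective.comp hli y.repr.injective
  exact fun S T h => end_ext_weightVec y fun u _ => hinj <| by
    rw [← baseMap_weightVec, ← baseMap_weightVec, h]

variable {ι F : Type*} [AddCommGroup E] [Module ℚ E] [AddCommGroup F] [Module ℚ F]
  {P : RootPairing ι ℚ E F} {b : P.Base} (hΨ : IsMinusculeUnion b Ψ)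
  (y : Module.Basis Ψ ℤ N) (z : Module.Basis Ψ R M)

theorem baseMap_eMap (i : b.support) : baseMap y z (eMap hΨ y i) = eMap hΨ z i :=
  end_ext_weightVec z fun v _ => by
    rw [baseMap_weightVec, eMap_weightVec, eMap_weightVec, apply_ite (baseVec y z), map_zero,
      baseVec_weightVec]

theorem baseMap_fMap (i : b.support) : baseMap y z (fMap hΨ y i) = fMap hΨ z i :=
  end_ext_weightVec z fun v _ => by
    rw [baseMap_weightVec, fMap_weightVec, fMap_weightVec, apply_ite (baseVec y z), map_zero,
      baseVec_weightVec]

theorem map_baseMap_nWord (w : List b.support) :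
    Units.map (baseMap y z : Module.End ℤ N →* Module.End R M) (nWord hΨ y w) =
      nWord hΨ z w := by
  have hnElt (i : b.support) :
      Units.map (baseMap y z : Module.End ℤ N →* Module.End R M) (nElt hΨ y i 1) =
        nElt hΨ z i 1 :=
    Units.ext (by simp [val_nElt_one, baseMap_eMap, baseMap_fMap])
  simp only [nWord, map_list_prod, List.map_map, Function.comp_def, hnElt]

theorem baseMap_vec {a : ι} (r : RootWord b a) :
    baseMap y z (r.vec hΨ y) = r.vec hΨ z := by
  rw [RootWord.vec, RootWord.vec, ← baseMap_eMap hΨ y z, ← map_baseMap_nWord hΨ y z,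
    ConjAct.units_smul_def, ConjAct.units_smul_def, map_mul, map_mul, ← map_inv]
  rfl

end BaseChange

section IntegralForm

attribute [local instance] LieRing.ofAssociativeRing

variable {ι E F : Type*} [AddCommGroup E] [Module ℚ E] [AddCommGroup F] [Module ℚ F]
  {P : RootPairing ι ℚ E F} {b : P.Base} {Ψ : Set E} {N : Type*} [AddCommGroup N] {a a' : ι}

/-- The integral form of `chevalleyAlgebra`: the operators on the lattice with basis `y` whose base
change to `ℚ` lies in `chevalleyAlgebra`. -/
def integralChevalleyAlgebra (hΨ : IsMinusculeUnion b Ψ)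
    (y : Module.Basis Ψ ℤ N) : AddSubgroup (Module.End ℤ N) :=
  (chevalleyAlgebra hΨ (Finsupp.basisSingleOne : Module.Basis Ψ ℚ (Ψ →₀ ℚ))).toAddSubgroup.comap
    (baseMap y Finsupp.basisSingleOne).toAddMonoidHom

variable {hΨ : IsMinusculeUnion b Ψ} {y : Module.Basis Ψ ℤ N}
  {T : Module.End ℤ N}

theorem mem_integralChevalleyAlgebra : T ∈ integralChevalleyAlgebra hΨ y ↔
    baseMap y Finsupp.basisSingleOne T ∈
      chevalleyAlgebra hΨ (Finsupp.basisSingleOne : Module.Basis Ψ ℚ (Ψ →₀ ℚ)) :=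
  Iff.rfl

variable [Finite ι] [P.IsCrystallographic]

namespace RootWord

theorem vec_mem_integralChevalleyAlgebra (r : RootWord b a) :
    r.vec hΨ y ∈ integralChevalleyAlgebra hΨ y := by
  rw [mem_integralChevalleyAlgebra, baseMap_vec]
  exact r.vec_mem_chevalleyAlgebra

theorem lie_vec_vec_mem_integralChevalleyAlgebra (r : RootWord b a) (r' : RootWord b a') :
    ⁅r.vec hΨ y, r'.vec hΨ y⁆ ∈ integralChevalleyAlgebra hΨ y := by
  rw [mem_integralChevalleyAlgebra, Ring.lie_def, map_sub, map_mul, map_mul, baseMap_vec,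
    baseMap_vec]
  exact r.lie_vec_mem_chevalleyAlgebra r'.vec_mem_chevalleyAlgebra

/-- Since `e_α² = 0`, this is the divided power `e_α e_β e_α = -[e_α, [e_α, e_β]] / 2`. -/
theorem vec_mul_vec_mul_vec_mem_integralChevalleyAlgebra (r : RootWord b a) (r' : RootWord b a') :
    r.vec hΨ y * r'.vec hΨ y * r.vec hΨ y ∈ integralChevalleyAlgebra hΨ y := by
  rw [mem_integralChevalleyAlgebra, map_mul, map_mul, baseMap_vec, baseMap_vec]
  have hlie := r.lie_vec_mem_chevalleyAlgebra (r.lie_vec_mem_chevalleyAlgebra (hΨ := hΨ)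
    (z := Finsupp.basisSingleOne) r'.vec_mem_chevalleyAlgebra)
  rw [lie_lie_eq_neg_two_smul (r.vec_mul_self hΨ _)] at hlie
  exact (Submodule.smul_mem_iff _ (by norm_num)).1 hlie

theorem exists_eq_zsmul_vec (r : RootWord b a) (hT : T ∈ integralChevalleyAlgebra hΨ y)
    (hTa : HasWeight y T (P.root a)) : ∃ m : ℤ, T = m • r.vec hΨ y := by
  let z : Module.Basis Ψ ℚ (Ψ →₀ ℚ) := Finsupp.basisSingleOne
  obtain ⟨q, hq⟩ := r.exists_eq_smul_vec (mem_integralChevalleyAlgebra.1 hT) (hTa.baseMap z)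
  by_cases h : ∃ u ∈ Ψ, P.coroot' a u = -1
  · obtain ⟨u, hu, hua⟩ := h
    obtain ⟨n, hn⟩ := hTa u
    obtain ⟨ε, hε⟩ := r.exists_vec_weightVec hΨ z u
    have hz : weightVec z (u + P.root a) ≠ 0 :=
      weightVec_coe (z := z) ⟨_, hΨ.add_mem a hu hua⟩ ▸ z.ne_zero _
    have hqn : q * (ε : ℤ) = n := smul_left_injective ℚ hz <| by
      have hqu := LinearMap.congr_fun hq (weightVec z u)
      rwa [LinearMap.smul_apply, hε, if_pos hua, baseMap_weightVec, hn, map_zsmul,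
        baseVec_weightVec, Units.smul_def, ← Int.cast_smul_eq_zsmul ℚ, smul_smul,
        ← Int.cast_smul_eq_zsmul ℚ] at hqu
    have hq' : q = (ε * n : ℤ) := by
      rw [Int.cast_mul, ← hqn, mul_left_comm, ← Int.cast_mul, ← Units.val_mul, Int.units_mul_self,
        Units.val_one, Int.cast_one, mul_one]
    refine ⟨ε * n, baseMap_injective y z ?_⟩
    rw [← hq, hq', map_zsmul, baseMap_vec]
    exact Int.cast_smul_eq_zsmul ℚ (ε * n : ℤ) (r.vec hΨ z)
  · have hvec : r.vec hΨ z = 0 := end_ext_weightVec z fun u hu => by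
      obtain ⟨ε, hε⟩ := r.exists_vec_weightVec hΨ z u
      rw [hε, if_neg fun hua => h ⟨u, hu, hua⟩, LinearMap.zero_apply]
    refine ⟨0, baseMap_injective y z ?_⟩
    rw [← hq, hvec, smul_zero, zero_smul, map_zero]

end RootWord

variable {R M : Type*} [CommRing R] [AddCommGroup M] [Module R M] (z : Module.Basis Ψ R M)

theorem RootWord.exists_vec_eq_zsmul_vec (hΨ : IsMinusculeUnion b Ψ) (r r' : RootWord b a) :
    ∃ m : ℤ, r.vec hΨ z = m • r'.vec hΨ z := by
  let y : Module.Basis Ψ ℤ (Ψ →₀ ℤ) := Finsupp.basisSingleOne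
  obtain ⟨m, hm⟩ :=
    r'.exists_eq_zsmul_vec r.vec_mem_integralChevalleyAlgebra (r.hasWeight_vec hΨ y)
  exact ⟨m, by rw [← baseMap_vec hΨ y z, hm, map_zsmul, baseMap_vec]⟩

theorem baseMap_eq_zero_or_exists_eq_zsmul_vec (c : ∀ a, RootWord b a)
    (hT : T ∈ integralChevalleyAlgebra hΨ y) {w : List b.support} (hw : w ≠ [])
    (hTw : HasWeight y T (wordSum w)) :
    baseMap y z T = 0 ∨
      ∃ (k : ι) (m : ℤ), P.root k = wordSum w ∧ baseMap y z T = m • (c k).vec hΨ z := by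
  obtain rfl | hT0 := eq_or_ne T 0
  · exact .inl (map_zero _)
  obtain ⟨k, hk⟩ := wordSum_mem_range_root_of_hasWeight (mem_integralChevalleyAlgebra.1 hT)
    ((map_ne_zero_iff _ (baseMap_injective y _)).2 hT0) hw (hTw.baseMap _)
  obtain ⟨m, hm⟩ := (c k).exists_eq_zsmul_vec hT (hk ▸ hTw)
  exact .inr ⟨k, m, hk, by rw [hm, map_zsmul, baseMap_vec]⟩

end IntegralForm

section RootSubgroups

attribute [local instance] LieRing.ofAssociativeRing

theorem commutator_one_add_smul {R A : Type*} [CommRing R] [Ring A] [Algebra R A] {a b : A}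
    (ha : a * a = 0) (hb : b * b = 0) (hbab : b * a * b = 0) (t u : R) :
    (1 + t • a) * (1 + u • b) * (1 - t • a) * (1 - u • b) =
      (1 + (t * u) • ⁅a, b⁆) * (1 + (-(t * t * u)) • (a * b * a)) := by
  have ha' (x : A) : a * (a * x) = 0 := by rw [← mul_assoc, ha, zero_mul]
  have hbab' : b * (a * b) = 0 := by rw [← mul_assoc, hbab]
  have hbab'' (x : A) : b * (a * (b * x)) = 0 := by
    rw [← mul_assoc a, ← mul_assoc b, hbab', zero_mul]
  simp only [Ring.lie_def, mul_add, add_mul, mul_sub, sub_mul, smul_sub, smul_add, one_mul, mul_one,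
    smul_mul_assoc, mul_smul_comm, mul_assoc, ha, hb, ha', hbab', hbab'', smul_zero, mul_zero,
    zero_mul]
  module

section Unip

variable {R M : Type*} [CommRing R] [AddCommGroup M] [Module R M] {e : Module.End R M}

theorem unip_mul_unip (he : e * e = 0) (t u : R) :
    unip e he t * unip e he u = unip e he (t + u) := by
  refine Units.ext (show (1 + t • e) * (1 + u • e) = 1 + (t + u) • e from ?_)
  simp only [mul_add, add_mul, one_mul, mul_one, smul_mul_assoc, mul_smul_comm, he, smul_zero]
  module

theorem conj_unip (g : LinearMap.GeneralLinearGroup R M) {e' : Module.End R M}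
    (he : e * e = 0) (he' : e' * e' = 0) (h : ConjAct.toConjAct g • e = e') (t : R) :
    g * unip e he t * g⁻¹ = unip e' he' t := by
  subst h
  refine Units.ext ?_
  change ConjAct.toConjAct g • (1 + t • e) = 1 + t • ConjAct.toConjAct g • e
  rw [smul_add, smul_one, smul_comm]

end Unip

variable {ι E F : Type*} [AddCommGroup E] [Module ℚ E] [AddCommGroup F] [Module ℚ F]
  {P : RootPairing ι ℚ E F} {b : P.Base} {Ψ : Set E}
  {R M : Type*} [CommRing R] [AddCommGroup M] [Module R M]
  (hΨ : IsMinusculeUnion b Ψ) (z : Module.Basis Ψ R M) (c : ∀ a, RootWord b a) {a a' : ι}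

namespace RootWord

/-- The root subgroup `X_α = {id + t e_α | t ∈ R}` as a subgroup of `GL(M)`, for the root vector
`e_α` attached to a single expression of `α`. -/
def subgroup (r : RootWord b a) : Subgroup (LinearMap.GeneralLinearGroup R M) where
  carrier := Set.range (unip (r.vec hΨ z) (r.vec_mul_self hΨ z))
  one_mem' := ⟨0, Units.ext (show 1 + (0 : R) • _ = 1 by simp)⟩
  mul_mem' := by
    rintro _ _ ⟨t, rfl⟩ ⟨u, rfl⟩
    exact ⟨t + u, (unip_mul_unip _ t u).symm⟩
  inv_mem' := by
    rintro _ ⟨t, rfl⟩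
    exact ⟨-t, (unip_inv _ _ t).symm⟩

variable {z} in
theorem mem_subgroup_of_val_eq (r : RootWord b a) {g : LinearMap.GeneralLinearGroup R M} {t : R}
    {m : ℤ} (hg : (g : Module.End R M) = 1 + t • m • r.vec hΨ z) : g ∈ r.subgroup hΨ z :=
  ⟨t * m, Units.ext (show 1 + (t * m) • r.vec hΨ z = g by
    rw [hg, mul_smul, Int.cast_smul_eq_zsmul])⟩

theorem map_conj_nElt_subgroup_eq_cons (i : b.support) (r : RootWord b a) :
    (r.subgroup hΨ z).map (MulAut.conj (nElt hΨ z i 1)).toMonoidHom =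
      (r.cons i).subgroup hΨ z := by
  refine SetLike.coe_injective ?_
  rw [Subgroup.coe_map]
  refine (Set.range_comp _ _).symm.trans (congrArg Set.range (funext fun t => ?_))
  exact conj_unip _ _ _ (toConjAct_nElt_smul_vec hΨ z i r) t

theorem subgroup_le_chevalleyGroup (r : RootWord b a) :
    r.subgroup hΨ z ≤ chevalleyGroup hΨ z := by
  rintro _ ⟨t, rfl⟩
  have hn := nWord_mem_chevalleyGroup hΨ z r.word
  rw [← conj_unip (nWord hΨ z r.word) (eMap_mul_self hΨ z r.node) (r.vec_mul_self hΨ z) rfl]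
  exact mul_mem (mul_mem hn (xSimple_mem_chevalleyGroup hΨ z _ t)) (inv_mem hn)

theorem subgroup_eq [Finite ι] [P.IsCrystallographic] (r r' : RootWord b a) :
    r.subgroup hΨ z = r'.subgroup hΨ z := by
  suffices ∀ s s' : RootWord b a, s.subgroup hΨ z ≤ s'.subgroup hΨ z from
    le_antisymm (this r r') (this r' r)
  rintro s s' _ ⟨t, rfl⟩
  obtain ⟨m, hm⟩ := s.exists_vec_eq_zsmul_vec z hΨ s'
  exact s'.mem_subgroup_of_val_eq hΨ (m := m) (t := t) (hm ▸ rfl)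

end RootWord

theorem coe_subgroup_eq_rootSubgroup (a : ι) :
    ((c a).subgroup hΨ z : Set (LinearMap.GeneralLinearGroup R M)) = rootSubgroup hΨ z c a :=
  rfl

section Commutators

variable [Finite ι] [P.IsCrystallographic]

theorem exists_mem_biSup_subgroup_val_eq {N : Type*} [AddCommGroup N] {y : Module.Basis Ψ ℤ N}
    {T : Module.End ℤ N} (hT : T ∈ integralChevalleyAlgebra hΨ y) {w : List b.support}
    (hw : w ≠ []) (hTw : HasWeight y T (wordSum w)) {S : Set ι}
    (hS : ∀ k, P.root k = wordSum w → k ∈ S) (t : R) :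
    ∃ g ∈ ⨆ k ∈ S, (c k).subgroup hΨ z, (g : Module.End R M) = 1 + t • baseMap y z T := by
  obtain h | ⟨k, m, hk, hm⟩ := baseMap_eq_zero_or_exists_eq_zsmul_vec z c hT hw hTw
  · exact ⟨1, one_mem _, by simp [h]⟩
  · refine ⟨unip ((c k).vec hΨ z) ((c k).vec_mul_self hΨ z) (t * m), ?_, ?_⟩
    · exact le_biSup (fun k => (c k).subgroup hΨ z) (hS k hk) ⟨_, rfl⟩
    · rw [hm, ← Int.cast_smul_eq_zsmul R, smul_smul]
      rfl

/-- The case of Chevalley's commutator relation in which `e_β e_α e_β = 0`. -/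
theorem commutator_subgroup_le_of_pairing_ne (ha : b.IsPos a) (ha' : b.IsPos a')
    (h : P.pairing a a' ≠ -2) : ⁅(c a).subgroup hΨ z, (c a').subgroup hΨ z⁆ ≤
      ⨆ k ∈ {k | b.height a < b.height k ∧ b.height a' < b.height k}, (c k).subgroup hΨ z := by
  rw [Subgroup.commutator_le]
  rintro _ ⟨t, rfl⟩ _ ⟨u, rfl⟩
  let y : Module.Basis Ψ ℤ (Ψ →₀ ℤ) := Finsupp.basisSingleOne
  have hwa := (c a).hasWeight_vec hΨ y
  have hwa' := (c a').hasWeight_vec hΨ y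
  obtain ⟨w, hw, hwr⟩ := exists_root_eq_wordSum ha
  obtain ⟨w', -, hwr'⟩ := exists_root_eq_wordSum ha'
  rw [RootPairing.Base.isPos_iff] at ha ha'
  obtain ⟨g, hg, hgval⟩ := exists_mem_biSup_subgroup_val_eq hΨ z c (w := w ++ w')
    (S := {k | b.height a < b.height k ∧ b.height a' < b.height k})
    ((c a).lie_vec_vec_mem_integralChevalleyAlgebra (c a')) (by simp [hw])
    (by rw [wordSum_append, ← hwr, ← hwr']; exact hwa.lie hwa')
    (fun k hk => by
      rw [wordSum_append, ← hwr, ← hwr'] at hk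
      have := b.height_add hk
      exact ⟨by omega, by omega⟩) (t * u)
  obtain ⟨g', hg', hgval'⟩ := exists_mem_biSup_subgroup_val_eq hΨ z c (w := w ++ w' ++ w)
    (S := {k | b.height a < b.height k ∧ b.height a' < b.height k})
    ((c a).vec_mul_vec_mul_vec_mem_integralChevalleyAlgebra (c a')) (by simp [hw])
    (by rw [wordSum_append, wordSum_append, ← hwr, ← hwr']; exact (hwa.mul hwa').mul hwa)
    (fun k hk => by
      rw [wordSum_append, wordSum_append, ← hwr, ← hwr', add_right_comm, ← two_zsmul,
        add_comm] at hk
      have := b.height_add_zsmul hk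
      rw [smul_eq_mul] at this
      exact ⟨by omega, by omega⟩) (-(t * t * u))
  rw [Ring.lie_def, map_sub, map_mul, map_mul, baseMap_vec, baseMap_vec, ← Ring.lie_def] at hgval
  rw [map_mul, map_mul, baseMap_vec, baseMap_vec] at hgval'
  convert mul_mem hg hg'
  refine Units.ext ?_
  rw [Units.val_mul, hgval, hgval', ← commutator_one_add_smul ((c a).vec_mul_self hΨ z)
    ((c a').vec_mul_self hΨ z) ((c a').vec_mul_vec_mul_vec_eq_zero hΨ z (c a) h)]
  rfl

theorem commutator_subgroup_le (ha : b.IsPos a) (ha' : b.IsPos a') :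
    ⁅(c a).subgroup hΨ z, (c a').subgroup hΨ z⁆ ≤
      ⨆ k ∈ {k | b.height a < b.height k ∧ b.height a' < b.height k}, (c k).subgroup hΨ z := by
  by_cases h : P.pairing a a' = -2
  · simp_rw [Subgroup.commutator_comm ((c a).subgroup hΨ z), and_comm (a := b.height a < _)]
    refine commutator_subgroup_le_of_pairing_ne hΨ z c ha' ha fun h' => ?_
    have hneg : a = P.reflectionPerm a' a' := P.root.injective <| by
      rw [RootPairing.root_reflectionPerm, RootPairing.reflection_apply_self,
        (P.pairing_neg_two_neg_two_iff a a').1 ⟨h, h'⟩]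
    have hheight : b.height a = -b.height a' := hneg ▸ b.height_reflectionPerm_self a'
    rw [RootPairing.Base.isPos_iff] at ha ha'
    omega
  · exact commutator_subgroup_le_of_pairing_ne hΨ z c ha ha' h

end Commutators

end RootSubgroups

section UnipotentRadical

variable {ι E F : Type*} [AddCommGroup E] [Module ℚ E] [AddCommGroup F] [Module ℚ F]
  {P : RootPairing ι ℚ E F} {b : P.Base} {Ψ : Set E}
  {R M : Type*} [CommRing R] [AddCommGroup M] [Module R M]
  (hΨ : IsMinusculeUnion b Ψ) (z : Module.Basis Ψ R M) (c : ∀ a, RootWord b a) (i : b.support)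

theorem uPlus_eq_biSup : uPlus hΨ z c = ⨆ a ∈ {a | b.IsPos a}, (c a).subgroup hΨ z := by
  refine le_antisymm ((Subgroup.closure_le _).2 ?_) (iSup₂_le ?_)
  · rintro _ ⟨a, t, ha, rfl⟩
    exact le_biSup (fun a => (c a).subgroup hΨ z) ha ⟨t, rfl⟩
  · rintro a ha _ ⟨t, rfl⟩
    exact Subgroup.subset_closure ⟨a, t, ha, rfl⟩

theorem uPlusMinus_eq_biSup :
    uPlusMinus hΨ z c i = ⨆ a ∈ {a | b.IsPos a ∧ a ≠ i}, (c a).subgroup hΨ z := by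
  simp_rw [uPlusMinus, Subgroup.closure_iUnion, ← coe_subgroup_eq_rootSubgroup, Subgroup.closure_eq]
  rfl

theorem uPlusMinus_le_uPlus : uPlusMinus hΨ z c i ≤ uPlus hΨ z c := by
  rw [uPlus_eq_biSup, uPlusMinus_eq_biSup]
  exact biSup_mono fun a => And.left

section Normality

variable [Finite ι] [P.IsCrystallographic]

theorem uPlus_eq_prod {l : List ι} (hl : ∀ a, a ∈ l ↔ b.IsPos a) :
    (uPlus hΨ z c : Set (LinearMap.GeneralLinearGroup R M)) =
      (l.map (rootSubgroup hΨ z c)).prod := by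
  rw [uPlus_eq_biSup]
  refine biSup_eq_prod_of_commutator_le (fun a => (b.height a).toNat) (fun a ha a' ha' => ?_) hl
  refine (commutator_subgroup_le hΨ z c ha ha').trans (biSup_mono fun k hk => ?_)
  have hpos := (b.isPos_iff.1 ha).trans hk.1
  exact ⟨b.isPos_iff.2 hpos, (Int.toNat_lt_toNat hpos).2 hk.2⟩

theorem uPlus_le_normalizer_uPlusMinus :
    uPlus hΨ z c ≤ Subgroup.normalizer (uPlusMinus hΨ z c i) := by
  rw [uPlus_eq_biSup, uPlusMinus_eq_biSup]
  refine biSup_le_normalizer_biSup fun a ha a' ha' => ?_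
  refine (commutator_subgroup_le hΨ z c ha ha'.1).trans (biSup_mono fun k hk => ?_)
  have hpos := b.isPos_iff.1 ha
  refine ⟨b.isPos_iff.2 (hpos.trans hk.1), fun hki => ?_⟩
  have hheight := b.height_one_of_mem_support i.2
  rw [← hki] at hheight
  have := hk.1
  omega

theorem uPlus_eq_rootSubgroup_mul :
    (uPlus hΨ z c : Set (LinearMap.GeneralLinearGroup R M)) =
      rootSubgroup hΨ z c i *
        (uPlusMinus hΨ z c i : Set (LinearMap.GeneralLinearGroup R M)) := by
  have hi : (c i).subgroup hΨ z ≤ uPlus hΨ z c := uPlus_eq_biSup hΨ z c ▸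
    le_biSup (fun a => (c a).subgroup hΨ z) (RootPairing.Base.isPos_of_mem_support i.2)
  have hsup : uPlus hΨ z c = (c i).subgroup hΨ z ⊔ uPlusMinus hΨ z c i := by
    refine le_antisymm ?_ (sup_le hi (uPlusMinus_le_uPlus hΨ z c i))
    rw [uPlus_eq_biSup, uPlusMinus_eq_biSup]
    refine iSup₂_le fun a ha => ?_
    obtain rfl | hai := eq_or_ne a i
    · exact le_sup_left
    · exact le_sup_of_le_right (le_biSup (fun a => (c a).subgroup hΨ z) ⟨ha, hai⟩)
  rw [hsup, Subgroup.coe_mul_of_left_le_normalizer_right _ _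
    (hi.trans (uPlus_le_normalizer_uPlusMinus hΨ z c i)), coe_subgroup_eq_rootSubgroup]

end Normality

section Conjugation

variable [Finite ι] [P.IsCrystallographic]

theorem map_conj_nElt_subgroup (a : ι) :
    ((c a).subgroup hΨ z).map (MulAut.conj (nElt hΨ z i 1)).toMonoidHom =
      (c (P.reflectionPerm i a)).subgroup hΨ z := by
  rw [RootWord.map_conj_nElt_subgroup_eq_cons, RootWord.subgroup_eq]

theorem image_conj_nElt_rootSubgroup (a : ι) :
    (fun g => nElt hΨ z i 1 * g * (nElt hΨ z i 1)⁻¹) '' rootSubgroup hΨ z c a =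
      rootSubgroup hΨ z c (P.reflectionPerm i a) :=
  congrArg SetLike.coe (map_conj_nElt_subgroup hΨ z c i a)

theorem isPos_reflectionPerm_and_ne [P.IsReduced] {i : b.support} {a : ι}
    (h : b.IsPos a ∧ a ≠ i) : b.IsPos (P.reflectionPerm i a) ∧ P.reflectionPerm i a ≠ i := by
  refine ⟨h.1.reflectionPerm i.2 h.2, fun hi => ?_⟩
  have hneg : a = P.reflectionPerm i i := by
    conv_rhs => enter [2]; rw [← hi]
    rw [RootPairing.reflectionPerm_self]
  have hheight : b.height a = -b.height i := hneg ▸ b.height_reflectionPerm_self i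
  rw [b.height_one_of_mem_support i.2] at hheight
  have := b.isPos_iff.1 h.1
  omega

theorem image_conj_nElt_uPlusMinus [P.IsReduced] :
    (fun g => nElt hΨ z i 1 * g * (nElt hΨ z i 1)⁻¹) ''
      (uPlusMinus hΨ z c i : Set (LinearMap.GeneralLinearGroup R M)) = uPlusMinus hΨ z c i := by
  suffices (uPlusMinus hΨ z c i).map (MulAut.conj (nElt hΨ z i 1)).toMonoidHom =
    uPlusMinus hΨ z c i from congrArg SetLike.coe this
  simp_rw [uPlusMinus_eq_biSup, Subgroup.map_iSup, map_conj_nElt_subgroup]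
  refine (P.reflectionPerm i).iSup_congr fun a => iSup_congr_Prop ⟨fun h => ?_,
    isPos_reflectionPerm_and_ne⟩ fun _ => rfl
  simpa using isPos_reflectionPerm_and_ne h

end Conjugation

end UnipotentRadical

end

end MinusculeChevalley

theorem corollary3p3_general {ι E F : Type*} [Finite ι]
    [AddCommGroup E] [Module ℚ E] [AddCommGroup F] [Module ℚ F]
    (P : RootPairing ι ℚ E F) [P.IsCrystallographic] [P.IsReduced] (b : P.Base)
    (Ψ : Set E) (hΨ : MinusculeChevalley.IsMinusculeUnion b Ψ)
    {R M : Type*} [CommRing R] [AddCommGroup M] [Module R M] (z : Module.Basis Ψ R M)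
    (c : ∀ a, MinusculeChevalley.RootWord b a) :
    (∀ a, MinusculeChevalley.rootSubgroup hΨ z c a ⊆ MinusculeChevalley.chevalleyGroup hΨ z) ∧
    (∀ l : List ι, (∀ a, a ∈ l ↔ b.IsPos a) →
      (MinusculeChevalley.uPlus hΨ z c : Set (LinearMap.GeneralLinearGroup R M)) =
        (l.map (MinusculeChevalley.rootSubgroup hΨ z c)).prod) ∧
    ∀ i : b.support,
      MinusculeChevalley.uPlusMinus hΨ z c i ≤ MinusculeChevalley.uPlus hΨ z c ∧
      ((MinusculeChevalley.uPlusMinus hΨ z c i).subgroupOf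
        (MinusculeChevalley.uPlus hΨ z c)).Normal ∧
      (MinusculeChevalley.uPlus hΨ z c : Set (LinearMap.GeneralLinearGroup R M)) =
        MinusculeChevalley.rootSubgroup hΨ z c i *
          (MinusculeChevalley.uPlusMinus hΨ z c i : Set (LinearMap.GeneralLinearGroup R M)) ∧
      (fun g => MinusculeChevalley.nElt hΨ z i 1 * g * (MinusculeChevalley.nElt hΨ z i 1)⁻¹) ''
          MinusculeChevalley.rootSubgroup hΨ z c i =
        MinusculeChevalley.rootSubgroup hΨ z c (MinusculeChevalley.negIdx P i) ∧
      (fun g => MinusculeChevalley.nElt hΨ z i 1 * g * (MinusculeChevalley.nElt hΨ z i 1)⁻¹) ''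
          (MinusculeChevalley.uPlusMinus hΨ z c i : Set (LinearMap.GeneralLinearGroup R M)) =
        (MinusculeChevalley.uPlusMinus hΨ z c i : Set (LinearMap.GeneralLinearGroup R M)) := by
  refine ⟨fun a => (c a).subgroup_le_chevalleyGroup hΨ z,
    fun _ hl => MinusculeChevalley.uPlus_eq_prod hΨ z c hl,
    fun i => ⟨MinusculeChevalley.uPlusMinus_le_uPlus hΨ z c i, ?_,
      MinusculeChevalley.uPlus_eq_rootSubgroup_mul hΨ z c i,
      MinusculeChevalley.image_conj_nElt_rootSubgroup hΨ z c i i,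
      MinusculeChevalley.image_conj_nElt_uPlusMinus hΨ z c i⟩⟩
  exact Subgroup.normal_subgroupOf_of_le_normalizer
    (MinusculeChevalley.uPlus_le_normalizer_uPlusMinus hΨ z c i)

theorem corollary3p3 {ι E F : Type*} [Finite ι]
    [AddCommGroup E] [Module ℚ E] [AddCommGroup F] [Module ℚ F]
    (P : RootPairing ι ℚ E F) [P.IsRootSystem] [P.IsCrystallographic] [P.IsReduced]
    [P.IsIrreducible] (b : P.Base)
    (Ψ : Set E) (hΨ : MinusculeChevalley.IsMinusculeUnion b Ψ)
    {R M : Type*} [CommRing R] [AddCommGroup M] [Module R M] (z : Module.Basis Ψ R M)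
    (c : ∀ a, MinusculeChevalley.RootWord b a) :
    (∀ a, MinusculeChevalley.rootSubgroup hΨ z c a ⊆ MinusculeChevalley.chevalleyGroup hΨ z) ∧
    (∀ l : List ι, l.Nodup → (∀ a, a ∈ l ↔ b.IsPos a) →
      (MinusculeChevalley.uPlus hΨ z c : Set (LinearMap.GeneralLinearGroup R M)) =
        (l.map (MinusculeChevalley.rootSubgroup hΨ z c)).prod) ∧
    ∀ i : b.support,
      MinusculeChevalley.uPlusMinus hΨ z c i ≤ MinusculeChevalley.uPlus hΨ z c ∧
      ((MinusculeChevalley.uPlusMinus hΨ z c i).subgroupOf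
        (MinusculeChevalley.uPlus hΨ z c)).Normal ∧
      (MinusculeChevalley.uPlus hΨ z c : Set (LinearMap.GeneralLinearGroup R M)) =
        MinusculeChevalley.rootSubgroup hΨ z c i *
          (MinusculeChevalley.uPlusMinus hΨ z c i : Set (LinearMap.GeneralLinearGroup R M)) ∧
      (fun g => MinusculeChevalley.nElt hΨ z i 1 * g * (MinusculeChevalley.nElt hΨ z i 1)⁻¹) ''
          MinusculeChevalley.rootSubgroup hΨ z c i =
        MinusculeChevalley.rootSubgroup hΨ z c (MinusculeChevalley.negIdx P i) ∧
      (fun g => MinusculeChevalley.nElt hΨ z i 1 * g * (MinusculeChevalley.nElt hΨ z i 1)⁻¹) ''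
          (MinusculeChevalley.uPlusMinus hΨ z c i : Set (LinearMap.GeneralLinearGroup R M)) =
        (MinusculeChevalley.uPlusMinus hΨ z c i : Set (LinearMap.GeneralLinearGroup R M)) := by
  have ⟨hG, hprod, hU⟩ := corollary3p3_general P b Ψ hΨ z c
  exact ⟨hG, fun l _ => hprod l, hU⟩
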